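/- There is a universal constant $A>0$ with the following property. Let $(X_n)$ be a sequence of real-valued random variables (possibly defined on different probability spaces), and let $r_n>0$ be real numbers such that, for every $n$, $\mathbb{E}[e^{r_n|X_n|}]<\infty$, the variance $\sigma_n^2$ of $X_n$ satisfies $\sigma_n>0$, and the characteristic function $u\mapsto\mathbb{E}[e^{iuX_n}]$ has no zero on the closed disk $\{u\in\mathbb{C}:|u|\le r_n\}$. Write $\log^+:=\max(\log,0)$ and assume that $$\lim_{n\to\infty}\frac{1+\log^+\log\sup_{|u|=r_n}|\mathbb{E}[e^{iuX_n}]|}{r_n\sigma_n}=0,$$ where the supremum is over complex $u$ with $|u|=r_n$. Then the normalized variables $\hat X_n:=(X_n-\mathbb{E}[X_n])/\sigma_n$ converge in law to the standard Gaussian $N(0,1)$ as $n\to\infty$. Moreover, for every $n$, $$\sup_{x\in\mathbb{R}}\big|\mathbb{P}(\hat X_n\le x)-\Phi(x)\big|\le\frac{A\,\big(1+\log^+\log\sup_{|u|=r_n}|\mathbb{E}[e^{iuX_n}]|\big)}{r_n\sigma_n},$$ where $\Phi$ is the cumulative distribution function of $N(0,1)$. -/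

import Mathlib

open MeasureTheory ProbabilityTheory Filter Topology

noncomputable section

/-- The characteristic function `Ψ(u) = E[exp(i u X)]` at a complex argument `u`. It is a genuine
(convergent) expectation as soon as `E[exp(r |X|)]` is finite for some `r ≥ |Im u|`. -/
def complexCharFun {Ω : Type*} [MeasurableSpace Ω] (P : Measure Ω) (X : Ω → ℝ) (u : ℂ) : ℂ :=
  ∫ ω, Complex.exp (Complex.I * u * (X ω : ℂ)) ∂P

/-- The supremum of `|E[exp(i u X)]|` over the circle `|u| = r`. -/
def circleSup {Ω : Type*} [MeasurableSpace Ω] (P : Measure Ω) (X : Ω → ℝ) (r : ℝ) : ℝ :=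
  sSup ((fun u : ℂ => ‖complexCharFun P X u‖) '' Metric.sphere (0 : ℂ) r)

/-- The standard deviation `σ` of `X`. -/
def stdDev {Ω : Type*} [MeasurableSpace Ω] (P : Measure Ω) (X : Ω → ℝ) : ℝ :=
  Real.sqrt (variance X P)

/-- The centered and normalized random variable `(X - E[X]) / σ`. -/
def standardize {Ω : Type*} [MeasurableSpace Ω] (P : Measure Ω) (X : Ω → ℝ) (ω : Ω) : ℝ :=
  (X ω - ∫ ω', X ω' ∂P) / stdDev P X

/-- The Kolmogorov–Smirnov distance between two probability laws on the line: the supremum of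
the absolute difference of their cumulative distribution functions. -/
def ksDist (μ ν : Measure ℝ) : ℝ :=
  ⨆ x : ℝ, |cdf μ x - cdf ν x|

/-- The quantity `(1 + log⁺ log sup_{|u| = r} |E[exp(i u X)]|) / (r σ)`. -/
def cltRatio {Ω : Type*} [MeasurableSpace Ω] (P : Measure Ω) (X : Ω → ℝ) (r : ℝ) : ℝ :=
  (1 + Real.posLog (Real.log (circleSup P X r))) / (r * stdDev P X)

end

/-! On a disk where the characteristic function has no zero, E[e^{zX}] = exp K(z) with K
holomorphic, and the trivial bound |E[e^{zX}]| ≤ E[e^{Re(z) X}] turns into the ridge inequality Re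
K(z) ≤ K(Re z). Everything is deduced from this inequality, from K being real on the real axis, and
from an upper bound for Re K.

The heart is `IsRidgeExponent.exists_norm_deriv_deriv_le`: on a disk of radius 2Y, if |K''| ≤ e^{4Y}
|K''(0)| on |z| ≤ Y, then |K''| ≤ C |K''(0)| on |z| < 2, with C universal. It combines two
mechanisms. (a) Let M be the maximum of |K''| on [-1, 1]. By the ridge inequality, a tangent line
plus a constant minus K has nonnegative real part on a vertical strip, so Harnack's inequality
carries bounds for K'' from the real axis to the imaginary axis. There the growth rate becomes
exp(O(√|x|)), and a maximum principle on a half-disk brings the gain back to the real axis.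
Iterating yields |K''(y)| ≤ e^{44|y|} M, whatever Y is. (b) For n ≥ 3 a real monomial a z^n violates
the ridge inequality in some direction. Hence a small quadratic coefficient forces finitely many
further Taylor coefficients to be small, and therefore K'' on the whole unit disk; applied to K/M,
this shows that |K''(0)| cannot be much smaller than M.

The double logarithm in the ratio comes from (a): an exponential rate in Y is allowed, so Y need
only be comparable to 1 + log⁺ log sup. Rescaling the disk of radius r to radius 2Y makes K''(0) =
τ² with 1/τ = 8 `cltRatio`. The cubic Taylor remainder at it/τ is then O(|t|³/τ), so the
standardized characteristic function is close to e^{-t²/2} for |t| up to order τ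
(`exists_norm_charFun_sub_le`). Esseen's smoothing inequality and Lévy's continuity theorem finish
the proof. -/

/-! ### Carathéodory and Harnack estimates for functions with nonnegative real part. -/

open Metric in
/-- Carathéodory's bound for the derivative of a function with nonnegative real part. -/
lemma norm_deriv_le_of_re_nonneg {p : ℂ → ℂ} {c : ℂ} {t : ℝ} (ht : 0 < t)
    (hp : DifferentiableOn ℂ p (ball c t)) (hre : ∀ z ∈ ball c t, 0 ≤ (p z).re) :
    ‖deriv p c‖ ≤ 2 * (p c).re / t := by
  have hc : c ∈ ball c t := mem_ball_self ht
  refine le_of_forall_pos_le_add fun ε' hε' => ?_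
  -- The shift by ε makes `a` have positive real part, so that the Cayley transform `g` below has no
  -- pole; Schwarz's lemma for `g` costs an error 2ε/t = ε'.
  set ε : ℝ := ε' * t / 2 with hε
  have hεpos : 0 < ε := by positivity
  set a : ℂ := p c + ε with ha
  have hare : 0 < a.re := by
    have := hre c hc
    simp [ha]; linarith
  have hden : ∀ z ∈ ball c t, p z + ε + (starRingEnd ℂ) a ≠ 0 := by
    intro z hz h
    have h1 := congrArg Complex.re h
    have h2 := hre z hz
    simp only [Complex.add_re, Complex.ofReal_re, Complex.conj_re, Complex.zero_re] at h1
    linarith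
  set g : ℂ → ℂ := fun z => (p z - p c) / (p z + ε + (starRingEnd ℂ) a) with hg
  have hgd : DifferentiableOn ℂ g (ball c t) :=
    (hp.sub_const _).div ((hp.add_const _).add_const _) hden
  have hgc : g c = 0 := by simp [hg]
  have hmaps : Set.MapsTo g (ball c t) (ball (g c) 1) := by
    intro z hz
    have hd := hden z hz
    rw [hgc, mem_ball_zero_iff, hg]
    simp only [norm_div]
    rw [div_lt_one (norm_pos_iff.mpr hd)]
    have h2 := hre z hz
    refine lt_of_pow_lt_pow_left₀ 2 (norm_nonneg _) ?_
    rw [← Complex.normSq_eq_norm_sq, ← Complex.normSq_eq_norm_sq, Complex.normSq_apply,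
      Complex.normSq_apply]
    have h3 := hre c hc
    simp only [ha, Complex.sub_re, Complex.sub_im, Complex.add_re, Complex.add_im,
      Complex.ofReal_re, Complex.ofReal_im, Complex.conj_re, Complex.conj_im]
    nlinarith [mul_pos hεpos hεpos, mul_nonneg h2 h3, mul_nonneg h2 hεpos.le,
      mul_nonneg h3 hεpos.le]
  have hgb := Complex.norm_deriv_le_div_of_mapsTo_ball hgd
    (hmaps.mono_right ball_subset_closedBall) ht
  have hpd : HasDerivAt p (deriv p c) c :=
    (hp.differentiableAt (isOpen_ball.mem_nhds hc)).hasDerivAt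
  have hgd' := (hpd.sub_const (p c)).div ((hpd.add_const (ε : ℂ)).add_const ((starRingEnd ℂ) a))
    (hden c hc)
  have hsum : p c + ε + (starRingEnd ℂ) a = ((2 * a.re : ℝ) : ℂ) := by
    rw [← ha, Complex.add_conj]
  have hgd2 : deriv g c = deriv p c / ((2 * a.re : ℝ) : ℂ) := by
    rw [show g = (fun x => p x - p c) / fun x => p x + ↑ε + (starRingEnd ℂ) a from rfl, hgd'.deriv]
    rw [hsum]
    have : ((2 * a.re : ℝ) : ℂ) ≠ 0 := by exact_mod_cast (by positivity : (2 * a.re : ℝ) ≠ 0)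
    field_simp
    ring
  rw [hgd2, norm_div, Complex.norm_real, Real.norm_of_nonneg (by positivity),
    div_le_iff₀ (by positivity)] at hgb
  refine hgb.trans (le_of_eq ?_)
  have : a.re = (p c).re + ε := by simp [ha]
  rw [this, hε]
  field_simp

open Metric in
/-- Harnack's inequality along a segment. -/
lemma re_le_exp_mul_re {p : ℂ → ℂ} {S : Set ℂ} {z₀ z₁ : ℂ} {t : ℝ} (ht : 0 < t)
    (hp : DifferentiableOn ℂ p S) (hre : ∀ z ∈ S, 0 ≤ (p z).re)
    (hS : ∀ s ∈ Set.Icc (0 : ℝ) 1, ball (z₀ + s * (z₁ - z₀)) t ⊆ S) :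
    (p z₁).re ≤ Real.exp (2 * ‖z₁ - z₀‖ / t) * (p z₀).re := by
  set l : ℝ := 2 * ‖z₁ - z₀‖ / t with hl
  -- Carathéodory's bound is the differential inequality (Re p)' ≤ l Re p along the segment, so φ is
  -- antitone (Grönwall).
  set φ : ℝ → ℝ := fun s => (p (z₀ + s * (z₁ - z₀))).re * Real.exp (-(l * s)) with hφ
  have hder : ∀ s ∈ Set.Icc (0 : ℝ) 1, HasDerivAt φ
      ((deriv p (z₀ + s * (z₁ - z₀)) * (z₁ - z₀)).re * Real.exp (-(l * s)) +
        (p (z₀ + s * (z₁ - z₀))).re * (Real.exp (-(l * s)) * (-l))) s := by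
    intro s hs
    have hpd : HasDerivAt p (deriv p (z₀ + s * (z₁ - z₀))) (z₀ + s * (z₁ - z₀)) :=
      ((hp.mono (hS s hs)).differentiableAt (isOpen_ball.mem_nhds (mem_ball_self ht))).hasDerivAt
    have h1 : HasDerivAt (fun w : ℂ => z₀ + w * (z₁ - z₀)) (z₁ - z₀) (s : ℂ) := by
      simpa using ((hasDerivAt_id (s : ℂ)).mul_const (z₁ - z₀)).const_add z₀
    have h2 := (hpd.comp (s : ℂ) h1).real_of_complex
    have h3 : HasDerivAt (fun s : ℝ => Real.exp (-(l * s))) (Real.exp (-(l * s)) * (-l)) s := by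
      have := ((hasDerivAt_id s).const_mul l).neg.exp
      simpa using this
    exact h2.mul h3
  have hanti : AntitoneOn φ (Set.Icc 0 1) := by
    refine antitoneOn_of_deriv_nonpos (convex_Icc 0 1)
      (fun s hs => (hder s hs).continuousAt.continuousWithinAt)
      (fun s hs => (hder s (interior_subset hs)).differentiableAt.differentiableWithinAt) ?_
    intro s hs
    have hs' := interior_subset hs
    rw [(hder s hs').deriv]
    have hb := norm_deriv_le_of_re_nonneg ht (hp.mono (hS s hs')) (fun z hz => hre z (hS s hs' hz))
    have h4 : (deriv p (z₀ + s * (z₁ - z₀)) * (z₁ - z₀)).re ≤ l * (p (z₀ + s * (z₁ - z₀))).re := by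
      refine (Complex.re_le_norm _).trans ?_
      rw [norm_mul]
      refine (mul_le_mul_of_nonneg_right hb (norm_nonneg _)).trans (le_of_eq ?_)
      rw [hl]; ring
    have h5 := Real.exp_pos (-(l * s))
    nlinarith
  have h01 := hanti (Set.left_mem_Icc.mpr zero_le_one) (Set.right_mem_Icc.mpr zero_le_one)
    zero_le_one
  simp only [hφ, Complex.ofReal_one, one_mul, add_sub_cancel, mul_one, Complex.ofReal_zero,
    zero_mul, add_zero, mul_zero, Real.exp_zero, Real.exp_neg] at h01
  rw [← div_eq_mul_inv, div_le_iff₀ (Real.exp_pos _)] at h01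
  linarith

open Metric in
/-- Carathéodory's bound for the second derivative of a function with nonnegative real part. -/
lemma norm_deriv_deriv_le_of_re_nonneg {p : ℂ → ℂ} {c : ℂ} {t : ℝ} (ht : 0 < t)
    (hp : DifferentiableOn ℂ p (ball c t)) (hre : ∀ z ∈ ball c t, 0 ≤ (p z).re) :
    ‖deriv (deriv p) c‖ ≤ 8 * Real.exp 2 * (p c).re / t ^ 2 := by
  have ht2 : 0 < t / 2 := by positivity
  have hsub : ∀ w, dist w c ≤ t / 2 → ball w (t / 2) ⊆ ball c t := fun w hw =>
    ball_subset_ball' (by linarith)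
  have hb : ∀ w, dist w c ≤ t / 2 → ‖deriv p w‖ ≤ 4 * Real.exp 2 * (p c).re / t := by
    intro w hw
    have h1 := norm_deriv_le_of_re_nonneg ht2 (hp.mono (hsub w hw))
      (fun z hz => hre z (hsub w hw hz))
    have h2 : (p w).re ≤ Real.exp (2 * ‖w - c‖ / (t / 2)) * (p c).re := by
      refine re_le_exp_mul_re ht2 hp hre fun s hs => hsub _ ?_
      rw [dist_eq_norm, add_sub_cancel_left, norm_mul, Complex.norm_real,
        Real.norm_of_nonneg hs.1, ← dist_eq_norm]
      exact (mul_le_of_le_one_left dist_nonneg hs.2).trans hw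
    have h3 : Real.exp (2 * ‖w - c‖ / (t / 2)) ≤ Real.exp 2 := by
      apply Real.exp_le_exp.mpr
      rw [dist_eq_norm] at hw
      rw [div_le_iff₀ ht2]; linarith
    have h4 : (p w).re ≤ Real.exp 2 * (p c).re :=
      h2.trans (mul_le_mul_of_nonneg_right h3 (hre c (mem_ball_self ht)))
    refine h1.trans ?_
    rw [div_le_div_iff₀ ht2 ht]
    nlinarith
  -- Cauchy's estimate for p' on the circle of radius t/2, where Harnack has cost only a factor e².
  have hd : DifferentiableOn ℂ (deriv p) (ball c t) := hp.deriv isOpen_ball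
  have hdc : DiffContOnCl ℂ (deriv p) (ball c (t / 2)) :=
    (hd.mono (closedBall_subset_ball (by linarith))).diffContOnCl_ball le_rfl
  refine (Complex.norm_deriv_le_of_forall_mem_sphere_norm_le ht2 hdc
    (fun z hz => hb z (le_of_eq hz))).trans (le_of_eq ?_)
  field_simp
  ring

/-! ### Ridge exponents and the transfer of bounds off the real axis. -/

/-- A branch `K` of the logarithm of a ridge function on the disk of radius `R`, real on the real
axis. -/
structure IsRidgeExponent (K : ℂ → ℂ) (R : ℝ) : Prop where
  differentiableOn : DifferentiableOn ℂ K (Metric.ball 0 R)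
  re_le : ∀ z ∈ Metric.ball (0 : ℂ) R, (K z).re ≤ (K (z.re : ℂ)).re
  im_eq_zero : ∀ y : ℝ, |y| < R → (K y).im = 0

lemma deriv_im_eq_zero_of_im_eq_zero {f : ℂ → ℂ} {R : ℝ}
    (hf : DifferentiableOn ℂ f (Metric.ball 0 R)) (him : ∀ y : ℝ, |y| < R → (f y).im = 0)
    {y : ℝ} (hy : |y| < R) : (deriv f y).im = 0 := by
  have hmem : (y : ℂ) ∈ Metric.ball (0 : ℂ) R := by simpa using hy
  have h := (hf.differentiableAt (Metric.isOpen_ball.mem_nhds hmem)).hasDerivAt.comp_ofReal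
  have h2 : HasDerivAt (fun s : ℝ => (f s).im) (deriv f y).im y := by
    exact Complex.imCLM.hasFDerivAt.comp_hasDerivAt y h
  have h3 : (fun s : ℝ => (f s).im) =ᶠ[𝓝 y] fun _ => 0 := by
    filter_upwards [(isOpen_lt continuous_abs continuous_const).mem_nhds hy] with s hs
    exact him s hs
  exact h2.unique ((hasDerivAt_const y (0 : ℝ)).congr_of_eventuallyEq h3)

namespace IsRidgeExponent

variable {K : ℂ → ℂ} {R : ℝ}

lemma deriv_im_eq_zero (hK : IsRidgeExponent K R) {y : ℝ} (hy : |y| < R) :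
    (deriv K y).im = 0 :=
  deriv_im_eq_zero_of_im_eq_zero hK.differentiableOn hK.im_eq_zero hy

lemma differentiableOn_deriv (hK : IsRidgeExponent K R) :
    DifferentiableOn ℂ (deriv K) (Metric.ball 0 R) :=
  hK.differentiableOn.deriv Metric.isOpen_ball

lemma differentiableOn_deriv_deriv (hK : IsRidgeExponent K R) :
    DifferentiableOn ℂ (deriv (deriv K)) (Metric.ball 0 R) :=
  hK.differentiableOn_deriv.deriv Metric.isOpen_ball

lemma norm_sub_linear_le (hK : IsRidgeExponent K R) {y₀ y t β : ℝ} (ht : |y₀| + t ≤ R)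
    (hβ : ∀ y : ℝ, |y - y₀| < t → ‖deriv (deriv K) y‖ ≤ β) (hy : |y - y₀| < t) :
    ‖K y - K y₀ - deriv K y₀ * (y - y₀)‖ ≤ β * t ^ 2 := by
  have hmem : ∀ s : ℝ, |s - y₀| < t → (s : ℂ) ∈ Metric.ball (0 : ℂ) R := by
    intro s hs
    rw [mem_ball_zero_iff, Complex.norm_real, Real.norm_eq_abs]
    have := abs_add_le (s - y₀) y₀
    rw [sub_add_cancel] at this
    linarith
  have ht0 : 0 < t := (abs_nonneg _).trans_lt hy
  have hβ0 : 0 ≤ β := (norm_nonneg _).trans (hβ y hy)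
  have hconv : Convex ℝ {s : ℝ | |s - y₀| < t} := by
    have : {s : ℝ | |s - y₀| < t} = Metric.ball y₀ t := by
      ext s; simp [Real.dist_eq]
    rw [this]; exact convex_ball _ _
  have h0 : |y₀ - y₀| < t := by simpa using ht0
  have h1 : ∀ s : ℝ, |s - y₀| < t → ‖deriv K s - deriv K y₀‖ ≤ β * t := by
    intro s hs
    have := hconv.norm_image_sub_le_of_norm_hasDerivWithin_le (f := fun s : ℝ => deriv K s)
      (f' := fun s : ℝ => deriv (deriv K) s) (C := β)
      (fun x hx => ((hK.differentiableOn_deriv.differentiableAt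
        (Metric.isOpen_ball.mem_nhds (hmem x hx))).hasDerivAt.comp_ofReal).hasDerivWithinAt)
      (fun x hx => hβ x hx) h0 hs
    refine this.trans (mul_le_mul_of_nonneg_left ?_ hβ0)
    rw [Real.norm_eq_abs]; exact hs.le
  have := hconv.norm_image_sub_le_of_norm_hasDerivWithin_le
    (f := fun s : ℝ => K s - deriv K y₀ * (s - y₀))
    (f' := fun s : ℝ => deriv K s - deriv K y₀) (C := β * t)
    (fun x hx => by
      have e1 := (hK.differentiableOn.differentiableAt
        (Metric.isOpen_ball.mem_nhds (hmem x hx))).hasDerivAt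
      have e2 := ((hasDerivAt_id (x : ℂ)).sub_const (y₀ : ℂ)).const_mul (deriv K y₀)
      have := (e1.sub e2).comp_ofReal
      simpa using this.hasDerivWithinAt)
    (fun x hx => h1 x hx) h0 hy
  rw [sub_self, mul_zero, sub_zero] at this
  have e : K y - K y₀ - deriv K y₀ * (y - y₀) = K y - deriv K y₀ * (y - y₀) - K y₀ := by ring
  rw [e]
  refine this.trans ?_
  rw [Real.norm_eq_abs, pow_two, ← mul_assoc]
  exact mul_le_mul_of_nonneg_left hy.le (by positivity)

/-- The second derivative of a ridge exponent off the real axis is controlled by its size on the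
real axis. -/
lemma norm_deriv_deriv_le (hK : IsRidgeExponent K R) {y₀ x t β : ℝ} (ht : 0 < t)
    (hR : |y₀| + |x| + t ≤ R)
    (hβ : ∀ y : ℝ, |y - y₀| < t → ‖deriv (deriv K) y‖ ≤ β) :
    ‖deriv (deriv K) (y₀ + x * Complex.I)‖ ≤
      8 * Real.exp 2 * Real.exp (2 * |x| / t) * β := by
  set S : Set ℂ := Metric.ball (0 : ℂ) R ∩ {w | |w.re - y₀| < t} with hSdef
  have hy₀R : |y₀| < R := by have := abs_nonneg x; linarith
  have hR' : |y₀| + t ≤ R := by have := abs_nonneg x; linarith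
  -- On the strip |Re z - y₀| < t, Re K(z) ≤ K(Re z), which exceeds the tangent line at y₀ by at
  -- most βt²; so Re p ≥ 0 there. Since p(y₀) = βt², the t² cancels in Carathéodory's second-order
  -- bound and t survives only in the Harnack factor.
  set p : ℂ → ℂ := fun z => K y₀ + deriv K y₀ * (z - y₀) + (β * t ^ 2 : ℝ) - K z with hp
  have hpd : DifferentiableOn ℂ p (Metric.ball 0 R) := by
    have := hK.differentiableOn
    fun_prop
  have hre : ∀ z ∈ S, 0 ≤ (p z).re := by
    rintro z ⟨hz, hzt⟩
    have h1 := hK.re_le z hz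
    have h2 := hK.norm_sub_linear_le hR' hβ hzt
    have h3 := (Complex.re_le_norm _).trans h2
    have h4 := hK.deriv_im_eq_zero hy₀R
    simp only [hp, Complex.sub_re, Complex.add_re, Complex.mul_re, Complex.ofReal_re,
      Complex.ofReal_im, Complex.sub_im, h4, zero_mul, sub_zero] at h3 ⊢
    linarith
  have hball : ∀ s ∈ Set.Icc (0 : ℝ) 1,
      Metric.ball ((y₀ : ℂ) + s * ((y₀ + x * Complex.I) - y₀)) t ⊆ S := by
    intro s hs w hw
    rw [add_sub_cancel_left, Metric.mem_ball, dist_eq_norm] at hw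
    constructor
    · rw [mem_ball_zero_iff]
      calc ‖w‖ = ‖(w - (y₀ + s * (x * Complex.I))) + (y₀ + s * (x * Complex.I))‖ := by
            rw [sub_add_cancel]
        _ ≤ ‖w - (y₀ + s * (x * Complex.I))‖ + (‖(y₀ : ℂ)‖ + ‖(s * (x * Complex.I) : ℂ)‖) :=
            (norm_add_le _ _).trans (by gcongr; exact norm_add_le _ _)
        _ < t + (|y₀| + |x|) := by
            simp only [norm_mul, Complex.norm_real, Real.norm_eq_abs, Complex.norm_I, mul_one] at hw ⊢
            rw [abs_of_nonneg hs.1]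
            have := mul_le_of_le_one_left (abs_nonneg x) hs.2
            linarith
        _ ≤ R := by linarith
    · have := (Complex.abs_re_le_norm _).trans_lt hw
      simpa using this
  have hSR : S ⊆ Metric.ball 0 R := Set.inter_subset_left
  have h1 := hball 1 (by simp)
  simp only [Complex.ofReal_one, one_mul, add_sub_cancel] at h1
  have h2 := norm_deriv_deriv_le_of_re_nonneg ht (hpd.mono (h1.trans hSR))
    (fun z hz => hre z (h1 hz))
  have h3 := re_le_exp_mul_re ht (hpd.mono hSR) hre hball
  have hp0 : (p y₀).re = β * t ^ 2 := by
    simp [hp, -Complex.ofReal_mul]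
  have hzmem : (y₀ + x * Complex.I : ℂ) ∈ Metric.ball (0 : ℂ) R :=
    hSR (h1 (Metric.mem_ball_self ht))
  have hder : deriv (deriv p) (y₀ + x * Complex.I) = -deriv (deriv K) (y₀ + x * Complex.I) := by
    have e1 : ∀ w ∈ Metric.ball (0 : ℂ) R, deriv p w = deriv K y₀ - deriv K w := by
      intro w hw
      have e1 := (hK.differentiableOn.differentiableAt (Metric.isOpen_ball.mem_nhds hw)).hasDerivAt
      have e2 := ((hasDerivAt_id w).sub_const (y₀ : ℂ)).const_mul (deriv K y₀)
      have := (((e2.const_add (K y₀)).add_const (((β * t ^ 2 : ℝ) : ℂ))).sub e1).deriv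
      rw [mul_one] at this
      exact this
    have e2 : deriv p =ᶠ[𝓝 (y₀ + x * Complex.I : ℂ)] fun w => deriv K y₀ - deriv K w := by
      filter_upwards [Metric.isOpen_ball.mem_nhds hzmem] with w hw using e1 w hw
    rw [e2.deriv_eq, deriv_const_sub]
  rw [hder, norm_neg] at h2
  refine h2.trans ?_
  rw [div_le_iff₀ (by positivity)]
  rw [hp0] at h3
  simp only [add_sub_cancel_left, norm_mul, Complex.norm_real, Real.norm_eq_abs, Complex.norm_I,
    mul_one] at h3
  calc 8 * Real.exp 2 * (p (y₀ + x * Complex.I)).re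
      ≤ 8 * Real.exp 2 * (Real.exp (2 * |x| / t) * (β * t ^ 2)) := by gcongr
    _ = _ := by ring

end IsRidgeExponent

/-! ### The principal square root on the closed right half-plane. -/

lemma Complex.cpow_half_sq (z : ℂ) : (z ^ (1 / 2 : ℂ)) ^ 2 = z := by
  rw [← Complex.cpow_nat_mul]
  norm_num

lemma Complex.cpow_half_re_nonneg {z : ℂ} (hz : 0 ≤ z.re) : 0 ≤ (z ^ (1 / 2 : ℂ)).re := by
  rcases eq_or_ne z 0 with rfl | h0
  · simp
  rw [Complex.cpow_def_of_ne_zero h0, Complex.exp_re]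
  refine mul_nonneg (Real.exp_pos _).le (Real.cos_nonneg_of_mem_Icc ?_)
  have him : (Complex.log z * (1 / 2)).im = z.arg / 2 := by
    rw [show (1 / 2 : ℂ) = ((1 / 2 : ℝ) : ℂ) by norm_num, Complex.im_mul_ofReal, Complex.log_im]
    ring
  rw [him]
  have := Complex.abs_arg_le_pi z
  rw [abs_le] at this
  constructor <;> linarith

/-- The root of ix has real and imaginary parts of equal modulus √(|x|/2), and √2 ≤ 3/2. -/
lemma Complex.sqrt_abs_le_cpow_half_re (x : ℝ) :
    Real.sqrt |x| ≤ 3 / 2 * ((x * Complex.I) ^ (1 / 2 : ℂ)).re := by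
  set w : ℂ := (x * Complex.I) ^ (1 / 2 : ℂ) with hw
  have hre : 0 ≤ w.re := Complex.cpow_half_re_nonneg (by simp)
  have hsq : w ^ 2 = x * Complex.I := Complex.cpow_half_sq _
  have h1 : w.re ^ 2 - w.im ^ 2 = 0 := by
    have := congrArg Complex.re hsq
    simp [pow_two] at this
    nlinarith
  have h2 : w.re ^ 2 + w.im ^ 2 = |x| := by
    have := congrArg norm hsq
    rw [norm_pow, ← Complex.normSq_eq_norm_sq, Complex.normSq_apply] at this
    simp at this
    nlinarith
  rw [Real.sqrt_le_left (by positivity)]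
  nlinarith [abs_nonneg x]

/-- The maximum principle on a half-disk needs continuity up to the boundary, including the branch
point 0. -/
lemma Complex.continuousOn_cpow_half :
    ContinuousOn (fun z : ℂ => z ^ (1 / 2 : ℂ)) {z | 0 ≤ z.re} := by
  intro z hz
  refine ContinuousAt.continuousWithinAt ?_
  rcases eq_or_ne z 0 with rfl | h0
  · rw [ContinuousAt, Complex.zero_cpow (by norm_num), tendsto_zero_iff_norm_tendsto_zero]
    have : ∀ w : ℂ, ‖w ^ (1 / 2 : ℂ)‖ = Real.sqrt ‖w‖ := by
      intro w
      rw [eq_comm, Real.sqrt_eq_iff_eq_sq (norm_nonneg _) (norm_nonneg _), ← norm_pow,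
        Complex.cpow_half_sq]
    simp only [this]
    have h : Continuous fun w : ℂ => Real.sqrt ‖w‖ := by fun_prop
    simpa using h.tendsto 0
  · refine continuousAt_cpow_const ?_
    rw [Complex.mem_slitPlane_iff]
    rcases lt_or_eq_of_le (show 0 ≤ z.re from hz) with h | h
    · exact Or.inl h
    · refine Or.inr fun him => h0 (Complex.ext h.symm him)

/-! ### Rescaling, and the growth of the second derivative along the real axis. -/

namespace IsRidgeExponent

variable {K : ℂ → ℂ} {R : ℝ}

lemma mono (hK : IsRidgeExponent K R) {R' : ℝ} (h : R' ≤ R) : IsRidgeExponent K R' where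
  differentiableOn := hK.differentiableOn.mono (Metric.ball_subset_ball h)
  re_le z hz := hK.re_le z (Metric.ball_subset_ball h hz)
  im_eq_zero y hy := hK.im_eq_zero y (hy.trans_le h)

lemma comp_mul (hK : IsRidgeExponent K R) {a R' : ℝ} (h : |a| * R' ≤ R) (ha : a ≠ 0) :
    IsRidgeExponent (fun z => K (a * z)) R' := by
  have ha' : 0 < |a| := abs_pos.mpr ha
  have hmem : ∀ z ∈ Metric.ball (0 : ℂ) R', (a * z : ℂ) ∈ Metric.ball (0 : ℂ) R := by
    intro z hz
    rw [mem_ball_zero_iff] at hz ⊢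
    rw [norm_mul, Complex.norm_real, Real.norm_eq_abs]
    nlinarith
  refine ⟨hK.differentiableOn.comp (by fun_prop) hmem, fun z hz => ?_, fun y hy => ?_⟩
  · have := hK.re_le _ (hmem z hz)
    rw [Complex.re_ofReal_mul, Complex.ofReal_mul] at this
    exact this
  · have := hK.im_eq_zero (a * y) (by rw [abs_mul]; nlinarith)
    rwa [Complex.ofReal_mul] at this

lemma const_mul (hK : IsRidgeExponent K R) {a : ℝ} (ha : 0 ≤ a) :
    IsRidgeExponent (fun z => a * K z) R := by
  refine ⟨hK.differentiableOn.const_mul _, fun z hz => ?_, fun y hy => ?_⟩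
  · rw [Complex.re_ofReal_mul, Complex.re_ofReal_mul]
    exact mul_le_mul_of_nonneg_left (hK.re_le z hz) ha
  · rw [Complex.im_ofReal_mul, hK.im_eq_zero y hy, mul_zero]

end IsRidgeExponent

lemma deriv_deriv_comp_mul (K : ℂ → ℂ) (a z : ℂ) :
    deriv (deriv fun w => K (a * w)) z = a ^ 2 * deriv (deriv K) (a * z) := by
  have h1 : deriv (fun w => K (a * w)) = fun w => a * deriv K (a * w) := by
    funext w
    rw [deriv_comp_mul_left, smul_eq_mul]
  rw [h1, deriv_const_mul_field, deriv_comp_mul_left, smul_eq_mul]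
  ring

lemma deriv_deriv_const_mul (K : ℂ → ℂ) (a z : ℂ) :
    deriv (deriv fun w => a * K w) z = a * deriv (deriv K) z := by
  have h1 : deriv (fun w => a * K w) = fun w => a * deriv K w := by
    funext w
    rw [deriv_const_mul_field]
  rw [h1, deriv_const_mul_field]

namespace IsRidgeExponent

variable {K : ℂ → ℂ} {R : ℝ}

lemma eight_mul_exp_two_le : 8 * Real.exp 2 ≤ Real.exp 5 := by
  have h1 : Real.exp 5 = Real.exp 1 ^ 3 * Real.exp 2 := by
    rw [← Real.exp_nat_mul, ← Real.exp_add]; norm_num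
  have h2 : (2 : ℝ) ≤ Real.exp 1 := by linarith [Real.add_one_le_exp (1 : ℝ)]
  have h3 : (2 : ℝ) ^ 3 ≤ Real.exp 1 ^ 3 := by gcongr
  rw [h1]
  have := Real.exp_pos 2
  nlinarith

/-- A strip of half-width t about the imaginary axis costs e^{2|x|/t} by Harnack and e^{At} through
the real-axis bound. Taking t of order √|x| balances the two, so a linear exponent on the real axis
becomes a square-root one on the imaginary axis; the factor 1/3 in t is what later halves A. -/
lemma norm_deriv_deriv_mul_I_le (hK : IsRidgeExponent K R) {Y A M : ℝ} (hY : 1 ≤ Y)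
    (hR : 2 * Y ≤ R) (hM : 0 < M) (hA : 0 ≤ A)
    (h1 : ∀ y : ℝ, |y| ≤ 1 → ‖deriv (deriv K) y‖ ≤ M)
    (h2 : ∀ y : ℝ, 1 ≤ |y| → |y| ≤ Y → ‖deriv (deriv K) y‖ ≤ Real.exp (A * |y|) * M)
    {x : ℝ} (hx : |x| ≤ Y) :
    ‖deriv (deriv K) (x * Complex.I)‖ ≤ Real.exp (5 + (6 + A / 3) * Real.sqrt |x|) * M := by
  set q : ℝ := Real.sqrt |x| with hq
  have hq0 : 0 ≤ q := Real.sqrt_nonneg _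
  have hqq : q * q = |x| := Real.mul_self_sqrt (abs_nonneg x)
  set t : ℝ := max 1 (q / 3) with ht
  have ht1 : 1 ≤ t := le_max_left _ _
  have htq : q / 3 ≤ t := le_max_right _ _
  have htY : t ≤ Y := max_le hY (by nlinarith)
  have hβ : ∀ y : ℝ, |y - 0| < t → ‖deriv (deriv K) y‖ ≤ Real.exp (A * (q / 3)) * M := by
    intro y hy
    rw [sub_zero] at hy
    rcases le_total |y| 1 with hy1 | hy1
    · refine (h1 y hy1).trans (le_mul_of_one_le_left hM.le ?_)
      exact Real.one_le_exp (by positivity)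
    · refine (h2 y hy1 (hy.le.trans htY)).trans ?_
      have : |y| ≤ q / 3 := by
        rcases lt_max_iff.mp hy with h | h
        · linarith
        · exact h.le
      gcongr
  have h := hK.norm_deriv_deriv_le (y₀ := 0) (x := x) (by linarith) (by simp; linarith) hβ
  rw [Complex.ofReal_zero, zero_add] at h
  refine h.trans ?_
  have hc : 2 * |x| / t ≤ 6 * q := by
    rw [div_le_iff₀ (by linarith)]
    nlinarith
  calc 8 * Real.exp 2 * Real.exp (2 * |x| / t) * (Real.exp (A * (q / 3)) * M)
      ≤ Real.exp 5 * Real.exp (6 * q) * (Real.exp (A * (q / 3)) * M) := by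
        gcongr
        exact eight_mul_exp_two_le
    _ = Real.exp (5 + (6 + A / 3) * q) * M := by
        rw [← mul_assoc, ← Real.exp_add, ← Real.exp_add]
        ring_nf

/-- One step of a three-lines argument, improving an exponential growth bound for the second
derivative on the positive real axis. -/
lemma growth_step_pos (hK : IsRidgeExponent K R) {Y A M : ℝ} (hY : 1 ≤ Y)
    (hR : 2 * Y ≤ R) (hM : 0 < M) (hA : 0 ≤ A)
    (h1 : ∀ y : ℝ, |y| ≤ 1 → ‖deriv (deriv K) y‖ ≤ M)
    (h2 : ∀ y : ℝ, 1 ≤ |y| → |y| ≤ Y → ‖deriv (deriv K) y‖ ≤ Real.exp (A * |y|) * M)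
    (h3 : ∀ z : ℂ, ‖z‖ ≤ Y → ‖deriv (deriv K) z‖ ≤ Real.exp (4 * Y) * M)
    {y : ℝ} (hy1 : 1 ≤ y) (hyY : y ≤ Y) :
    ‖deriv (deriv K) y‖ ≤ Real.exp ((A / 2 + 22) * y) * M := by
  have hY0 : 0 < Y := by linarith
  rcases eq_or_lt_of_le hyY with rfl | hyY
  · refine (h3 y (by simp [abs_of_pos hY0])).trans ?_
    gcongr
    nlinarith
  set d : ℝ := 3 / 2 * (6 + A / 3) with hd
  have hd0 : 0 ≤ d := by positivity
  -- Re e dominates the exponents known on the boundary of the half-disk: the root term absorbs the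
  -- growth on the imaginary axis (hence the 3/2 in d), and the quadratic term is at least 4Y on the
  -- arc, nonnegative on the imaginary axis and at most 8y on the real axis.
  set e : ℂ → ℂ := fun z => 5 + d * z ^ (1 / 2 : ℂ) + (4 / Y : ℝ) * (2 * Y * z - z ^ 2) with he
  set G : ℂ → ℂ := fun z => deriv (deriv K) z * Complex.exp (-e z) with hG
  set U : Set ℂ := {z | 0 < z.re} ∩ Metric.ball 0 Y with hU
  have hUo : IsOpen U := (isOpen_lt continuous_const Complex.continuous_re).inter Metric.isOpen_ball
  have hUc : closure U ⊆ {z | 0 ≤ z.re} ∩ Metric.closedBall 0 Y := by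
    refine closure_minimal ?_ ((isClosed_le continuous_const Complex.continuous_re).inter
      Metric.isClosed_closedBall)
    rintro z ⟨hz, hz'⟩
    exact ⟨(show 0 < z.re from hz).le, Metric.ball_subset_closedBall hz'⟩
  have hsub : Metric.closedBall (0 : ℂ) Y ⊆ Metric.ball 0 R :=
    Metric.closedBall_subset_ball (by linarith)
  have hF := hK.differentiableOn_deriv_deriv
  have hdc : DiffContOnCl ℂ G U := by
    constructor
    · intro z hz
      have hz1 : z ∈ Complex.slitPlane := Complex.mem_slitPlane_iff.mpr (Or.inl hz.1)
      have hFz : DifferentiableAt ℂ (deriv (deriv K)) z := hF.differentiableAt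
        (Metric.isOpen_ball.mem_nhds (hsub (Metric.ball_subset_closedBall hz.2)))
      have hez : DifferentiableAt ℂ e z := by
        have : DifferentiableAt ℂ (fun z : ℂ => z ^ (1 / 2 : ℂ)) z :=
          (differentiableAt_id).cpow_const hz1
        fun_prop
      exact (hFz.mul hez.neg.cexp).differentiableWithinAt
    · have hFc : ContinuousOn (deriv (deriv K)) (closure U) :=
        hF.continuousOn.mono fun z hz => hsub (hUc hz).2
      have hsc : ContinuousOn (fun z : ℂ => z ^ (1 / 2 : ℂ)) (closure U) :=
        Complex.continuousOn_cpow_half.mono fun z hz => (hUc hz).1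
      have hec : ContinuousOn e (closure U) := by fun_prop
      exact hFc.mul hec.neg.cexp
  have hnorm : ∀ z, ‖G z‖ = ‖deriv (deriv K) z‖ * Real.exp (-(e z).re) := by
    intro z
    rw [hG, norm_mul, Complex.norm_exp, Complex.neg_re]
  have here : ∀ z : ℂ, (e z).re = 5 + d * (z ^ (1 / 2 : ℂ)).re +
      4 / Y * (2 * Y * z.re - z.re ^ 2 + z.im ^ 2) := by
    intro z
    simp only [he, Complex.add_re, Complex.sub_re, pow_two, Complex.mul_re,
      Complex.mul_im, Complex.ofReal_re, Complex.ofReal_im]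
    simp
    left
    ring
  have hfr : ∀ z ∈ frontier U, ‖G z‖ ≤ M := by
    intro z hz
    rw [hUo.frontier_eq] at hz
    obtain ⟨hzre, hzn⟩ := hUc hz.1
    have hzre : 0 ≤ z.re := hzre
    rw [mem_closedBall_zero_iff] at hzn
    rw [hnorm, Real.exp_neg, ← div_eq_mul_inv, div_le_iff₀ (Real.exp_pos _), mul_comm]
    have hnsq : ‖z‖ ^ 2 = z.re ^ 2 + z.im ^ 2 := by
      rw [← Complex.normSq_eq_norm_sq, Complex.normSq_apply]; ring
    have hzreY : z.re ≤ Y := (Complex.re_le_norm z).trans hzn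
    rcases eq_or_lt_of_le hzre with h0 | h0
    · have hzI : z = z.im * Complex.I := by
        apply Complex.ext <;> simp [← h0]
      have him : |z.im| ≤ Y := (Complex.abs_im_le_norm z).trans hzn
      have h4 := hK.norm_deriv_deriv_mul_I_le hY hR hM hA h1 h2 him
      rw [← hzI] at h4
      refine h4.trans ?_
      gcongr
      rw [here, ← h0]
      have h5 := Complex.sqrt_abs_le_cpow_half_re z.im
      rw [← hzI] at h5
      have h6 : (6 + A / 3) * Real.sqrt |z.im| ≤ d * (z ^ (1 / 2 : ℂ)).re := by
        rw [hd]
        have : 0 ≤ 6 + A / 3 := by positivity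
        nlinarith
      have h7 : 0 ≤ 4 / Y * (2 * Y * 0 - 0 ^ 2 + z.im ^ 2) := by
        have : 0 ≤ 4 / Y * z.im ^ 2 := by positivity
        linarith
      linarith
    · have hzY : ‖z‖ = Y := by
        refine le_antisymm hzn (not_lt.mp fun h => hz.2 ⟨h0, by simpa using h⟩)
      refine (h3 z hzn).trans ?_
      gcongr
      rw [here]
      have h5 := Complex.cpow_half_re_nonneg hzre
      -- On |z| = Y the bracket equals Y² + 2 Re z (Y - Re z).
      have h6 : 4 * Y ≤ 4 / Y * (2 * Y * z.re - z.re ^ 2 + z.im ^ 2) := by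
        rw [div_mul_eq_mul_div, le_div_iff₀ hY0]
        rw [hzY] at hnsq
        nlinarith
      have h7 : 0 ≤ d * (z ^ (1 / 2 : ℂ)).re := mul_nonneg hd0 h5
      linarith
  have hyU : (y : ℂ) ∈ closure U := by
    refine subset_closure ⟨?_, ?_⟩
    · show 0 < (y : ℂ).re
      rw [Complex.ofReal_re]; linarith
    · rw [mem_ball_zero_iff, Complex.norm_real, Real.norm_eq_abs, abs_of_nonneg (by linarith)]
      exact hyY
  have hmax := Complex.norm_le_of_forall_mem_frontier_norm_le
    (Metric.isBounded_ball.subset Set.inter_subset_right) hdc hfr hyU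
  rw [hnorm, Real.exp_neg, ← div_eq_mul_inv, div_le_iff₀ (Real.exp_pos _), mul_comm] at hmax
  refine hmax.trans ?_
  gcongr
  rw [here]
  have hsq : ((y : ℂ) ^ (1 / 2 : ℂ)).re = Real.sqrt y := by
    rw [show (1 / 2 : ℂ) = ((1 / 2 : ℝ) : ℂ) by norm_num, ← Complex.ofReal_cpow (by linarith),
      Complex.ofReal_re, Real.sqrt_eq_rpow]
  rw [hsq, Complex.ofReal_re, Complex.ofReal_im]
  have h5 : Real.sqrt y ≤ y := by
    rw [Real.sqrt_le_left (by linarith)]; nlinarith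
  -- With y ≥ 1 the total exponent is at most 5y + (9 + A/2)y + 8y.
  have h6 : d * Real.sqrt y ≤ d * y := mul_le_mul_of_nonneg_left h5 hd0
  have h7 : 4 / Y * (2 * Y * y - y ^ 2 + 0 ^ 2) ≤ 8 * y := by
    rw [div_mul_eq_mul_div, div_le_iff₀ hY0]
    nlinarith [sq_nonneg y]
  have h8 : d * y = 9 * y + A / 2 * y := by rw [hd]; ring
  linarith

/-- The reflection z ↦ -z preserves ridge exponents and exchanges the two half-axes. -/
lemma growth_step (hK : IsRidgeExponent K R) {Y A M : ℝ} (hY : 1 ≤ Y)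
    (hR : 2 * Y ≤ R) (hM : 0 < M) (hA : 0 ≤ A)
    (h1 : ∀ y : ℝ, |y| ≤ 1 → ‖deriv (deriv K) y‖ ≤ M)
    (h2 : ∀ y : ℝ, 1 ≤ |y| → |y| ≤ Y → ‖deriv (deriv K) y‖ ≤ Real.exp (A * |y|) * M)
    (h3 : ∀ z : ℂ, ‖z‖ ≤ Y → ‖deriv (deriv K) z‖ ≤ Real.exp (4 * Y) * M)
    {y : ℝ} (hy1 : 1 ≤ |y|) (hyY : |y| ≤ Y) :
    ‖deriv (deriv K) y‖ ≤ Real.exp ((A / 2 + 22) * |y|) * M := by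
  rcases le_total 0 y with h0 | h0
  · rw [abs_of_nonneg h0] at *
    exact hK.growth_step_pos hY hR hM hA h1 h2 h3 hy1 hyY
  · have hK' : IsRidgeExponent (fun z => K ((-1 : ℝ) * z)) R := hK.comp_mul (by simp) (by norm_num)
    have hd : ∀ z : ℂ, deriv (deriv fun w => K ((-1 : ℝ) * w)) z = deriv (deriv K) (-z) := by
      intro z
      rw [deriv_deriv_comp_mul]
      simp
    rw [abs_of_nonpos h0] at *
    have := hK'.growth_step_pos hY hR hM hA
      (fun s hs => by
        rw [hd, ← Complex.ofReal_neg]; exact h1 _ (by rwa [abs_neg]))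
      (fun s hs hs' => by
        rw [hd, ← Complex.ofReal_neg, ← abs_neg]; exact h2 _ (by rwa [abs_neg]) (by rwa [abs_neg]))
      (fun z hz => by rw [hd]; exact h3 _ (by rwa [norm_neg])) hy1 hyY
    rw [hd] at this
    simpa using this

/-- A growth bound for the second derivative on the real axis that does not depend on the size of
the disk. -/
lemma growth_bound (hK : IsRidgeExponent K R) {Y M : ℝ} (hY : 1 ≤ Y)
    (hR : 2 * Y ≤ R) (hM : 0 < M)
    (h1 : ∀ y : ℝ, |y| ≤ 1 → ‖deriv (deriv K) y‖ ≤ M)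
    (h3 : ∀ z : ℂ, ‖z‖ ≤ Y → ‖deriv (deriv K) z‖ ≤ Real.exp (4 * Y) * M)
    {y : ℝ} (hy1 : 1 ≤ |y|) (hyY : |y| ≤ Y) :
    ‖deriv (deriv K) y‖ ≤ Real.exp (44 * |y|) * M := by
  -- The map A ↦ A/2 + 22 contracts to its fixed point 44; the a priori bound e^{4Y} permits the
  -- start A = 4Y + 44 because |y| ≥ 1.
  have hiter : ∀ n : ℕ, ∀ y : ℝ, 1 ≤ |y| → |y| ≤ Y →
      ‖deriv (deriv K) y‖ ≤ Real.exp ((4 * Y * (1 / 2) ^ n + 44) * |y|) * M := by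
    intro n
    induction n with
    | zero =>
      intro y hy hyY
      refine (h3 y (by simpa using hyY)).trans ?_
      refine mul_le_mul_of_nonneg_right (Real.exp_le_exp.mpr ?_) hM.le
      rw [pow_zero]
      nlinarith
    | succ n ih =>
      intro y hy hyY
      refine (hK.growth_step hY hR hM (by positivity) h1 ih h3 hy hyY).trans (le_of_eq ?_)
      ring_nf
  have hlim : Tendsto (fun n : ℕ => Real.exp ((4 * Y * (1 / 2) ^ n + 44) * |y|) * M) atTop
      (𝓝 (Real.exp ((4 * Y * 0 + 44) * |y|) * M)) := by
    have h0 : Tendsto (fun n : ℕ => ((1 : ℝ) / 2) ^ n) atTop (𝓝 0) :=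
      tendsto_pow_atTop_nhds_zero_of_lt_one (by norm_num) (by norm_num)
    exact (Real.continuous_exp.continuousAt.tendsto.comp
      (((h0.const_mul (4 * Y)).add_const 44).mul_const |y|)).mul_const M
  rw [mul_zero, zero_add] at hlim
  exact ge_of_tendsto' hlim fun n => hiter n y hy1 hyY

end IsRidgeExponent

/-! ### Taylor coefficients of ridge exponents. -/

lemma cos_pow_lt_one {n : ℕ} (hn : 3 ≤ n) : Real.cos (2 * Real.pi / n) ^ n < 1 := by
  have hn' : (3 : ℝ) ≤ n := by exact_mod_cast hn
  have hpi := Real.pi_pos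
  have h1 : 0 < 2 * Real.pi / n := by positivity
  have h2 : 2 * Real.pi / n < Real.pi := by
    rw [div_lt_iff₀ (by linarith)]; nlinarith
  have hs := Real.sin_pos_of_pos_of_lt_pi h1 h2
  have hc : |Real.cos (2 * Real.pi / n)| < 1 := by
    rw [← sq_lt_one_iff_abs_lt_one]
    nlinarith [Real.sin_sq_add_cos_sq (2 * Real.pi / n)]
  calc Real.cos (2 * Real.pi / n) ^ n ≤ |Real.cos (2 * Real.pi / n) ^ n| := le_abs_self _
    _ = |Real.cos (2 * Real.pi / n)| ^ n := abs_pow _ _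
    _ < 1 := pow_lt_one₀ (abs_nonneg _) hc (by omega)

/-- There is a gap `κ > 0` such that for either sign of the coefficient `a` the monomial `a z ^ n`
violates the ridge inequality by at least `κ |a|` somewhere on the unit circle. -/
lemma exists_angle_gap {n : ℕ} (hn : 3 ≤ n) :
    ∃ κ : ℝ, 0 < κ ∧ ∀ a : ℝ, ∃ φ : ℝ,
      κ * |a| ≤ a * (Real.cos (n * φ) - Real.cos φ ^ n) := by
  have hn0 : (n : ℝ) ≠ 0 := by positivity
  have hn' : (3 : ℝ) ≤ n := by exact_mod_cast hn
  have hgap := cos_pow_lt_one hn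
  -- The angle 2π/n makes cos(nφ) = 1 and serves a ≥ 0; the angle π/n makes it -1 and serves a ≤ 0.
  -- For n = 2 the difference is -sin²φ, which gives no constraint on a ≥ 0.
  refine ⟨min 1 (1 - Real.cos (2 * Real.pi / n) ^ n), lt_min one_pos (by linarith), fun a => ?_⟩
  rcases le_total 0 a with ha | ha
  · refine ⟨2 * Real.pi / n, ?_⟩
    rw [abs_of_nonneg ha, mul_div_cancel₀ _ hn0, Real.cos_two_pi, mul_comm]
    exact mul_le_mul_of_nonneg_left (min_le_right _ _) ha
  · refine ⟨Real.pi / n, ?_⟩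
    have hpi := Real.pi_pos
    have hcos : 0 ≤ Real.cos (Real.pi / n) := by
      refine Real.cos_nonneg_of_mem_Icc ⟨?_, ?_⟩
      · have : 0 < Real.pi / n := by positivity
        linarith
      · rw [div_le_div_iff₀ (by linarith) (by norm_num)]; nlinarith
    rw [abs_of_nonpos ha, mul_div_cancel₀ _ hn0, Real.cos_pi]
    have h1 := pow_nonneg hcos n
    have h2 : min 1 (1 - Real.cos (2 * Real.pi / n) ^ n) ≤ 1 := min_le_left _ _
    nlinarith

/-- The Taylor coefficients at the origin. -/
noncomputable def taylorCoeff (K : ℂ → ℂ) (n : ℕ) : ℂ := (n.factorial : ℂ)⁻¹ * iteratedDeriv n K 0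

lemma hasSum_taylorCoeff {K : ℂ → ℂ} {R : ℝ} (hK : DifferentiableOn ℂ K (Metric.ball 0 R)) {z : ℂ}
    (hz : z ∈ Metric.ball (0 : ℂ) R) : HasSum (fun n => taylorCoeff K n * z ^ n) (K z) := by
  have := Complex.hasSum_taylorSeries_on_ball hK hz
  simpa [taylorCoeff, smul_eq_mul, mul_comm, mul_assoc, mul_left_comm] using this

lemma taylorCoeff_deriv_deriv (K : ℂ → ℂ) (n : ℕ) :
    taylorCoeff (deriv (deriv K)) n = (n + 2) * (n + 1) * taylorCoeff K (n + 2) := by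
  have h : iteratedDeriv (n + 2) K = iteratedDeriv n (deriv (deriv K)) := by
    rw [iteratedDeriv_succ', iteratedDeriv_succ']
  rw [taylorCoeff, taylorCoeff, h, Nat.factorial_succ, Nat.factorial_succ]
  have h0 : (n.factorial : ℂ) ≠ 0 := by exact_mod_cast n.factorial_ne_zero
  have h1 : (n + 1 : ℂ) ≠ 0 := by exact_mod_cast n.succ_ne_zero
  have h2 : (n + 2 : ℂ) ≠ 0 := by exact_mod_cast (n + 1).succ_ne_zero
  push_cast
  have h3 : (n + 1 + 1 : ℂ) ≠ 0 := by convert h2 using 1; ring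
  field_simp
  ring

/-- Cauchy's estimate on the circle of radius 3/2. -/
lemma norm_taylorCoeff_le {G : ℂ → ℂ} {N : ℝ} (hG : DifferentiableOn ℂ G (Metric.ball 0 2))
    (hN : ∀ z ∈ Metric.ball (0 : ℂ) 2, ‖G z‖ ≤ N) (n : ℕ) : ‖taylorCoeff G n‖ ≤ N * (2 / 3) ^ n := by
  have hd : DiffContOnCl ℂ G (Metric.ball 0 (3 / 2)) :=
    (hG.mono (Metric.closedBall_subset_ball (by norm_num))).diffContOnCl_ball le_rfl
  have h := Complex.norm_iteratedDeriv_le_of_forall_mem_sphere_norm_le n (by norm_num) hd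
    (fun z hz => hN z (Metric.sphere_subset_closedBall.trans
      (Metric.closedBall_subset_ball (by norm_num)) hz))
  have hf : (0 : ℝ) < n.factorial := by exact_mod_cast n.factorial_pos
  rw [taylorCoeff, norm_mul, norm_inv, Complex.norm_natCast, inv_mul_le_iff₀ hf]
  refine h.trans (le_of_eq ?_)
  rw [mul_div_assoc, div_eq_mul_inv N, ← inv_pow]
  norm_num

lemma norm_taylorCoeff_le_deriv_deriv (K : ℂ → ℂ) (n : ℕ) :
    ‖taylorCoeff K (n + 2)‖ ≤ ‖taylorCoeff (deriv (deriv K)) n‖ := by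
  rw [taylorCoeff_deriv_deriv, norm_mul]
  refine le_mul_of_one_le_left (norm_nonneg _) ?_
  have : ((n : ℂ) + 2) * (n + 1) = (((n + 2) * (n + 1) : ℕ) : ℂ) := by push_cast; ring
  rw [this, Complex.norm_natCast]
  exact_mod_cast Nat.one_le_iff_ne_zero.mpr (by positivity)

namespace IsRidgeExponent

variable {K : ℂ → ℂ} {R : ℝ}

lemma taylorCoeff_im_eq_zero (hK : IsRidgeExponent K R) (hR : 0 < R) (k : ℕ) :
    (taylorCoeff K k).im = 0 := by
  have hall : ∀ (k : ℕ) (f : ℂ → ℂ), DifferentiableOn ℂ f (Metric.ball 0 R) →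
      (∀ y : ℝ, |y| < R → (f y).im = 0) → (iteratedDeriv k f 0).im = 0 := by
    intro k
    induction k with
    | zero =>
      intro f _ hf
      simpa using hf 0 (by simpa using hR)
    | succ k ih =>
      intro f hfd hf
      rw [iteratedDeriv_succ']
      exact ih _ (hfd.deriv Metric.isOpen_ball)
        fun y hy => deriv_im_eq_zero_of_im_eq_zero hfd hf hy
  rw [taylorCoeff, ← Complex.ofReal_natCast, ← Complex.ofReal_inv, Complex.im_ofReal_mul,
    hall k K hK.differentiableOn hK.im_eq_zero, mul_zero]

/-- This is the ridge inequality at z = re^{iφ}, expanded using that the coefficients are real. The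
terms k = 0, 1 vanish, so only the coefficients visible to K'' matter. -/
lemma ridge_series (hK : IsRidgeExponent K R) {r φ : ℝ} (hr0 : 0 ≤ r) (hr : r < R) :
    ∃ S ≤ 0, HasSum (fun k : ℕ => (taylorCoeff K k).re * r ^ k *
      (Real.cos (k * φ) - Real.cos φ ^ k)) S := by
  set z : ℂ := r * Complex.exp (φ * Complex.I) with hz
  have hzn : ‖z‖ = r := by
    rw [hz, norm_mul, Complex.norm_exp_ofReal_mul_I, mul_one, Complex.norm_real,
      Real.norm_of_nonneg hr0]
  have hzm : z ∈ Metric.ball (0 : ℂ) R := by rwa [mem_ball_zero_iff, hzn]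
  have hzre : z.re = r * Real.cos φ := by
    rw [hz, Complex.re_ofReal_mul, Complex.exp_ofReal_mul_I_re]
  have hym : (z.re : ℂ) ∈ Metric.ball (0 : ℂ) R := by
    rw [mem_ball_zero_iff, Complex.norm_real]
    exact ((Complex.abs_re_le_norm z).trans_eq hzn).trans_lt hr
  have hle := hK.re_le z hzm
  have hs := (hasSum_taylorCoeff hK.differentiableOn hzm).sub
    (hasSum_taylorCoeff hK.differentiableOn hym)
  have hs' := Complex.hasSum_re hs
  refine ⟨(K z - K z.re).re, by simpa using hle, ?_⟩
  convert hs' using 2 with k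
  have him := hK.taylorCoeff_im_eq_zero (hr0.trans_lt hr) k
  have hzk : (z ^ k).re = r ^ k * Real.cos (k * φ) := by
    rw [hz, mul_pow, ← Complex.exp_nat_mul, ← Complex.ofReal_pow, Complex.re_ofReal_mul]
    congr 1
    rw [← Complex.exp_ofReal_mul_I_re]
    push_cast
    ring_nf
  rw [← mul_sub, Complex.mul_re, him, zero_mul, sub_zero, Complex.sub_re, hzk, hzre,
    ← Complex.ofReal_pow, Complex.ofReal_re, mul_pow]
  ring

/-- If all lower coefficients are small, then so is the next one. -/
lemma taylorCoeff_step (hK : IsRidgeExponent K 3) {N ε r κ : ℝ} {n : ℕ}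
    (hN : ∀ z ∈ Metric.ball (0 : ℂ) 2, ‖deriv (deriv K) z‖ ≤ N)
    (hr0 : 0 < r) (hr1 : r ≤ 1) (hε : ∀ k, 2 ≤ k → k < n → ‖taylorCoeff K k‖ ≤ ε)
    (hε0 : 0 ≤ ε)
    (hκ : ∀ a : ℝ, ∃ φ : ℝ, κ * |a| ≤ a * (Real.cos (n * φ) - Real.cos φ ^ n)) :
    κ * ‖taylorCoeff K n‖ * r ^ n ≤ 2 * n * ε + 14 * N * r ^ (n + 1) := by
  have hN0 : 0 ≤ N := (norm_nonneg _).trans (hN 0 (by simp))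
  obtain ⟨φ, hφ⟩ := hκ (taylorCoeff K n).re
  obtain ⟨S, hS, hsum⟩ := hK.ridge_series (φ := φ) hr0.le (by linarith)
  set f : ℕ → ℝ := fun k => (taylorCoeff K k).re * r ^ k *
      (Real.cos (k * φ) - Real.cos φ ^ k) with hf
  have hreal : ‖taylorCoeff K n‖ = |(taylorCoeff K n).re| := by
    rw [Complex.abs_re_eq_norm.mpr (hK.taylorCoeff_im_eq_zero (by norm_num) n)]
  -- A majorant of all terms but the n-th: the trigonometric factor is at most 2, and for k > n the
  -- Cauchy bound N(2/3)^{k-2} and r^k ≤ r^{n+1} apply, whence 9/2 = 2·(3/2)². The geometric part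
  -- sums to 27/2 ≤ 14 times N r^{n+1}.
  set u : ℕ → ℝ := fun k => (if k < n then 2 * ε else 0) +
    9 / 2 * N * r ^ (n + 1) * (2 / 3) ^ k with hu
  have husum : HasSum u (2 * n * ε + 9 / 2 * N * r ^ (n + 1) * 3) := by
    refine HasSum.add ?_ ?_
    · have h1 : HasSum (fun k => if k < n then 2 * ε else 0)
          (∑ k ∈ Finset.range n, if k < n then 2 * ε else 0) :=
        hasSum_sum_of_ne_finset_zero fun k hk => if_neg (by simpa using hk)
      have h2 : (∑ k ∈ Finset.range n, if k < n then 2 * ε else 0) = 2 * n * ε := by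
        rw [Finset.sum_congr rfl fun k hk => if_pos (Finset.mem_range.mp hk)]
        simp
        ring
      rwa [h2] at h1
    · have := (hasSum_geometric_of_lt_one (r := (2 / 3 : ℝ)) (by norm_num) (by norm_num)).mul_left
        (9 / 2 * N * r ^ (n + 1))
      norm_num at this ⊢
      exact this
  have hu0 : ∀ k, 0 ≤ u k := by
    intro k
    have : 0 ≤ (if k < n then 2 * ε else 0) := by split_ifs <;> positivity
    have : 0 ≤ 9 / 2 * N * r ^ (n + 1) * (2 / 3) ^ k := by positivity
    simp only [hu]; linarith
  have hcos : ∀ k : ℕ, |Real.cos (k * φ) - Real.cos φ ^ k| ≤ 2 := by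
    intro k
    have h1 := Real.abs_cos_le_one (k * φ)
    have h2 : |Real.cos φ ^ k| ≤ 1 := by
      rw [abs_pow]; exact pow_le_one₀ (abs_nonneg _) (Real.abs_cos_le_one φ)
    have := abs_sub (Real.cos (k * φ)) (Real.cos φ ^ k)
    linarith
  have hfu : ∀ k, k ≠ n → |f k| ≤ u k := by
    intro k hk
    rcases lt_or_gt_of_ne hk with hkn | hkn
    · rcases lt_or_ge k 2 with hk2 | hk2
      · have : f k = 0 := by
          interval_cases k <;> simp [hf]
        rw [this, abs_zero]
        exact hu0 k
      · have h1 : |f k| ≤ ε * 1 * 2 := by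
          rw [hf, abs_mul, abs_mul, abs_pow, abs_of_pos hr0]
          gcongr
          · exact (Complex.abs_re_le_norm _).trans (hε k hk2 hkn)
          · exact pow_le_one₀ hr0.le hr1
          · exact hcos k
        have : 0 ≤ 9 / 2 * N * r ^ (n + 1) * (2 / 3) ^ k := by positivity
        simp only [hu, if_pos hkn]
        linarith
    · rcases lt_or_ge k 2 with hk2 | hk2
      · have : f k = 0 := by
          interval_cases k <;> simp [hf]
        rw [this, abs_zero]
        exact hu0 k
      obtain ⟨j, rfl⟩ := Nat.exists_eq_add_of_le' hk2
      have hc := (norm_taylorCoeff_le_deriv_deriv K j).trans (norm_taylorCoeff_le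
        (hK.differentiableOn_deriv_deriv.mono (Metric.ball_subset_ball (by norm_num))) hN j)
      have h1 : |f (j + 2)| ≤ N * (2 / 3) ^ j * r ^ (n + 1) * 2 := by
        rw [hf, abs_mul, abs_mul, abs_pow, abs_of_pos hr0]
        refine mul_le_mul (mul_le_mul ((Complex.abs_re_le_norm _).trans hc)
          (pow_le_pow_of_le_one hr0.le hr1 hkn) (by positivity) (by positivity)) (hcos _)
          (abs_nonneg _) (by positivity)
      simp only [hu, if_neg (not_lt.mpr hkn.le)]
      refine h1.trans (le_of_eq ?_)
      rw [pow_add (2 / 3 : ℝ)]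
      ring
  have h1 := hsum.sub (hasSum_ite_eq n (f n))
  have h2 : -(2 * n * ε + 9 / 2 * N * r ^ (n + 1) * 3) ≤ S - f n := by
    refine hasSum_le (fun k => ?_) husum.neg h1
    by_cases hk : k = n
    · subst hk
      rw [if_pos rfl, sub_self]
      exact neg_nonpos.mpr (hu0 k)
    · rw [if_neg hk, sub_zero]
      exact (abs_le.mp (hfu k hk)).1
  have h3 : κ * ‖taylorCoeff K n‖ * r ^ n ≤ f n := by
    rw [hreal]
    calc κ * |(taylorCoeff K n).re| * r ^ n
        ≤ (taylorCoeff K n).re * (Real.cos (n * φ) - Real.cos φ ^ n) * r ^ n := by gcongr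
      _ = f n := by rw [hf]; ring
  have h4 : 0 ≤ N * r ^ (n + 1) := by positivity
  linarith

/-- For ridge exponents with bounded second derivative, finitely many Taylor coefficients are small
as soon as the quadratic one is. -/
lemma exists_forall_taylorCoeff_le {N : ℝ} (hN : 0 < N) (m : ℕ) : ∀ ε > 0, ∃ δ > 0, ∀ K : ℂ → ℂ,
    IsRidgeExponent K 3 → (∀ z ∈ Metric.ball (0 : ℂ) 2, ‖deriv (deriv K) z‖ ≤ N) →
    ‖deriv (deriv K) 0‖ ≤ δ → ∀ k, 2 ≤ k → k < m → ‖taylorCoeff K k‖ ≤ ε := by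
  induction m with
  | zero => exact fun ε _ => ⟨1, one_pos, fun K _ _ _ k _ hk => absurd hk (by omega)⟩
  | succ n ih =>
    intro ε hε
    rcases lt_or_ge n 2 with hn | hn
    · exact ⟨1, one_pos, fun K _ _ _ k _ hk => absurd hk (by omega)⟩
    rcases eq_or_lt_of_le hn with rfl | hn
    · refine ⟨ε, hε, fun K _ _ h k hk hk' => ?_⟩
      obtain rfl : k = 2 := by omega
      refine (norm_taylorCoeff_le_deriv_deriv K 0).trans ?_
      simpa [taylorCoeff] using h
    · obtain ⟨κ, hκ0, hκ⟩ := exists_angle_gap hn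
      -- In `taylorCoeff_step`, this r makes the higher terms at most κεr^n/2; the tolerance
      -- requested below for the lower coefficients contributes the other half.
      set r : ℝ := min 1 (κ * ε / (28 * N)) with hr
      have hr0 : 0 < r := lt_min one_pos (by positivity)
      have hr1 : r ≤ 1 := min_le_left _ _
      have hrN : 14 * N * r ≤ κ * ε / 2 := by
        have : r ≤ κ * ε / (28 * N) := min_le_right _ _
        rw [le_div_iff₀ (by positivity)] at this
        linarith
      have hn0 : (0 : ℝ) < n := by exact_mod_cast (by omega : 0 < n)
      obtain ⟨δ, hδ, h⟩ := ih (min ε (κ * ε * r ^ n / (4 * n))) (by positivity)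
      refine ⟨δ, hδ, fun K hK hKN hKδ k hk hkn => ?_⟩
      have hsmall := h K hK hKN hKδ
      rcases Nat.lt_succ_iff_lt_or_eq.mp hkn with hkn | rfl
      · exact (hsmall k hk hkn).trans (min_le_left _ _)
      · have hs := hK.taylorCoeff_step hKN hr0 hr1
          (fun j hj hj' => (hsmall j hj hj').trans (min_le_right _ _)) (by positivity) hκ
        have e1 : 2 * (k : ℝ) * (κ * ε * r ^ k / (4 * k)) = κ * ε / 2 * r ^ k := by
          field_simp
          ring
        have e2 : 14 * N * r ^ (k + 1) ≤ κ * ε / 2 * r ^ k := by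
          rw [pow_succ']
          have := pow_pos hr0 k
          nlinarith
        have e3 : κ * ‖taylorCoeff K k‖ * r ^ k ≤ κ * ε * r ^ k := by
          rw [e1] at hs
          linarith
        have e4 := le_of_mul_le_mul_right e3 (pow_pos hr0 k)
        exact le_of_mul_le_mul_left e4 hκ0

/-- A ridge exponent whose second derivative is bounded and very small at the origin has small second
derivative on the unit disk. -/
lemma exists_norm_deriv_deriv_le_half {N : ℝ} (hN : 0 < N) : ∃ δ > 0, ∀ K : ℂ → ℂ,
    IsRidgeExponent K 3 → (∀ z ∈ Metric.ball (0 : ℂ) 2, ‖deriv (deriv K) z‖ ≤ N) →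
    ‖deriv (deriv K) 0‖ ≤ δ → ∀ z : ℂ, ‖z‖ ≤ 1 → ‖deriv (deriv K) z‖ ≤ 1 / 2 := by
  -- The Taylor tail of K'' from order m on is then below 1/4, and ε is chosen so that the first m
  -- terms add at most another 1/4.
  obtain ⟨m, hm⟩ : ∃ m : ℕ, (2 / 3 : ℝ) ^ m < 1 / (12 * N) :=
    exists_pow_lt_of_lt_one (by positivity) (by norm_num)
  rw [lt_div_iff₀ (by positivity)] at hm
  set ε : ℝ := 1 / (4 * ((m + 1) * (m + 2) * (m + 1))) with hε
  have hε0 : 0 < ε := by positivity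
  obtain ⟨δ, hδ, h⟩ := exists_forall_taylorCoeff_le hN (m + 2) ε hε0
  refine ⟨δ, hδ, fun K hK hKN hKδ z hz => ?_⟩
  have hGd : DifferentiableOn ℂ (deriv (deriv K)) (Metric.ball 0 2) :=
    hK.differentiableOn_deriv_deriv.mono (Metric.ball_subset_ball (by norm_num))
  have hsum := hasSum_taylorCoeff hGd (z := z) (by rw [mem_ball_zero_iff]; linarith)
  set u : ℕ → ℝ := fun k => (if k < m then (m + 1) * (m + 2) * ε else 0) +
    if m ≤ k then N * (2 / 3) ^ k else 0 with hu
  have husum : HasSum u (m * ((m + 1) * (m + 2) * ε) + N * (2 / 3) ^ m * 3) := by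
    refine HasSum.add ?_ ?_
    · have h1 : HasSum (fun k => if k < m then (m + 1) * (m + 2) * ε else 0)
          (∑ k ∈ Finset.range m, if k < m then (m + 1) * (m + 2) * ε else 0) :=
        hasSum_sum_of_ne_finset_zero fun k hk => if_neg (by simpa using hk)
      have h2 : (∑ k ∈ Finset.range m, if k < m then (m + 1) * (m + 2) * ε else 0) =
          m * ((m + 1) * (m + 2) * ε) := by
        rw [Finset.sum_congr rfl fun k hk => if_pos (Finset.mem_range.mp hk)]
        simp
      rwa [h2] at h1
    · rw [← hasSum_nat_add_iff' m]
      have h0 : ∑ i ∈ Finset.range m, (if m ≤ i then N * (2 / 3 : ℝ) ^ i else 0) = 0 :=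
        Finset.sum_eq_zero fun i hi => if_neg (by simpa using hi)
      rw [h0, sub_zero]
      have := (hasSum_geometric_of_lt_one (r := (2 / 3 : ℝ)) (by norm_num) (by norm_num)).mul_left
        (N * (2 / 3) ^ m)
      have e1 : (fun k => if m ≤ k + m then N * (2 / 3 : ℝ) ^ (k + m) else 0) =
          fun k => N * (2 / 3) ^ m * (2 / 3) ^ k := by
        funext k
        rw [if_pos (by omega), pow_add]
        ring
      rw [e1]
      rwa [show (1 - 2 / 3 : ℝ)⁻¹ = 3 by norm_num] at this
  have hle : ∀ k, ‖taylorCoeff (deriv (deriv K)) k * z ^ k‖ ≤ u k := by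
    intro k
    have hz1 : ‖z ^ k‖ ≤ 1 := by rw [norm_pow]; exact pow_le_one₀ (norm_nonneg _) hz
    rw [norm_mul]
    refine (mul_le_of_le_one_right (norm_nonneg _) hz1).trans ?_
    rcases lt_or_ge k m with hk | hk
    · simp only [hu, if_pos hk, if_neg (not_le.mpr hk), add_zero]
      rw [taylorCoeff_deriv_deriv, norm_mul]
      have e1 : ((k : ℂ) + 2) * (k + 1) = (((k + 1) * (k + 2) : ℕ) : ℂ) := by push_cast; ring
      rw [e1, Complex.norm_natCast]
      have hkm : (k : ℝ) ≤ m := by exact_mod_cast hk.le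
      push_cast
      gcongr
      exact h K hK hKN hKδ (k + 2) (by omega) (by omega)
    · simp only [hu, if_neg (not_lt.mpr hk), if_pos hk, zero_add]
      exact norm_taylorCoeff_le hGd hKN k
  rw [← hsum.tsum_eq]
  refine (tsum_of_norm_bounded husum hle).trans ?_
  have e1 : (m : ℝ) * ((m + 1) * (m + 2) * ε) ≤ 1 / 4 := by
    have : ((m : ℝ) + 1) * ((m + 1) * (m + 2) * ε) = 1 / 4 := by
      rw [hε]; field_simp
    have h2 : 0 ≤ ((m : ℝ) + 1) * (m + 2) * ε := by positivity
    linarith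
  linarith

/-! ### Control of the second derivative by its value at the origin. -/

/-- The second derivative of a ridge exponent on a large disk is controlled near the origin by its
value at the origin, as long as it does not grow more than exponentially in the radius. -/
theorem exists_norm_deriv_deriv_le : ∃ C : ℝ, 0 < C ∧ ∀ (K : ℂ → ℂ) (Y : ℝ), 4 ≤ Y →
    IsRidgeExponent K (2 * Y) → deriv (deriv K) 0 ≠ 0 →
    (∀ z : ℂ, ‖z‖ ≤ Y → ‖deriv (deriv K) z‖ ≤ Real.exp (4 * Y) * ‖deriv (deriv K) 0‖) →
    ∀ z ∈ Metric.ball (0 : ℂ) 2, ‖deriv (deriv K) z‖ ≤ C * ‖deriv (deriv K) 0‖ := by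
  -- 183 = 44·4 + 5 + 2: growth on |y| < 4, then the constant 8e² ≤ e⁵ and the Harnack factor e^{|Im
  -- z|} ≤ e² of the transfer to |z| < 2.
  set N : ℝ := Real.exp 183 with hN
  have hN0 : 0 < N := Real.exp_pos _
  obtain ⟨δ, hδ, h⟩ := exists_norm_deriv_deriv_le_half hN0
  refine ⟨N / δ, by positivity, fun K Y hY hK h0 hgrow z hz => ?_⟩
  have hcont : ContinuousOn (fun y : ℝ => ‖deriv (deriv K) y‖) (Set.Icc (-1) 1) := by
    refine ContinuousOn.norm (hK.differentiableOn_deriv_deriv.continuousOn.comp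
      Complex.continuous_ofReal.continuousOn fun y hy => ?_)
    rw [mem_ball_zero_iff, Complex.norm_real, Real.norm_eq_abs]
    have := abs_le.mpr hy
    linarith
  obtain ⟨y₀, hy₀, hmax⟩ := isCompact_Icc.exists_isMaxOn ⟨0, by norm_num⟩ hcont
  set M : ℝ := ‖deriv (deriv K) y₀‖ with hM
  have h1 : ∀ y : ℝ, |y| ≤ 1 → ‖deriv (deriv K) y‖ ≤ M := fun y hy => hmax (abs_le.mp hy)
  have h0M : ‖deriv (deriv K) 0‖ ≤ M := by simpa using h1 0 (by simp)
  have hM0 : 0 < M := (norm_pos_iff.mpr h0).trans_le h0M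
  have h4 : ∀ y : ℝ, |y| < 4 → ‖deriv (deriv K) y‖ ≤ Real.exp 176 * M := by
    intro y hy
    rcases le_total |y| 1 with hy1 | hy1
    · exact (h1 y hy1).trans (le_mul_of_one_le_left hM0.le (Real.one_le_exp (by norm_num)))
    · refine (hK.growth_bound (by linarith) le_rfl hM0 h1 (fun z hz => (hgrow z hz).trans ?_) hy1
        (by linarith)).trans ?_
      · gcongr
      · gcongr
        linarith
  have hball : ∀ z ∈ Metric.ball (0 : ℂ) 2, ‖deriv (deriv K) z‖ ≤ N * M := by
    intro z hz
    rw [mem_ball_zero_iff] at hz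
    have hre := (Complex.abs_re_le_norm z).trans_lt hz
    have him := (Complex.abs_im_le_norm z).trans_lt hz
    have := hK.norm_deriv_deriv_le (y₀ := z.re) (x := z.im) (t := 2) (β := Real.exp 176 * M)
      (by norm_num) (by linarith) (fun y hy => h4 y (by
        have := abs_add_le (y - z.re) z.re
        rw [sub_add_cancel] at this
        linarith))
    rw [Complex.re_add_im] at this
    refine this.trans ?_
    calc 8 * Real.exp 2 * Real.exp (2 * |z.im| / 2) * (Real.exp 176 * M)
        ≤ Real.exp 5 * Real.exp 2 * (Real.exp 176 * M) := by
          gcongr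
          · exact eight_mul_exp_two_le
          · linarith
      _ = N * M := by
          rw [← mul_assoc, ← Real.exp_add, ← Real.exp_add, hN]; norm_num
  -- Otherwise K/M would have second derivative at most 1/2 on the unit disk, although it has
  -- modulus 1 at y₀.
  have hδM : δ * M < ‖deriv (deriv K) 0‖ := by
    by_contra hcon
    rw [not_lt] at hcon
    have hK1 : IsRidgeExponent (fun z => ((M⁻¹ : ℝ) : ℂ) * K z) 3 :=
      (hK.mono (by linarith)).const_mul (by positivity)
    have hd : ∀ z, ‖deriv (deriv fun z => ((M⁻¹ : ℝ) : ℂ) * K z) z‖ =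
        M⁻¹ * ‖deriv (deriv K) z‖ := by
      intro z
      rw [deriv_deriv_const_mul, norm_mul, Complex.norm_real, Real.norm_of_nonneg (by positivity)]
    have := h _ hK1 (fun z hz => by
        rw [hd, inv_mul_le_iff₀ hM0, mul_comm]; exact hball z hz)
      (by rw [hd, inv_mul_le_iff₀ hM0, mul_comm]; exact hcon) y₀
      (by rw [Complex.norm_real]; exact abs_le.mpr hy₀)
    rw [hd, ← hM, inv_mul_cancel₀ hM0.ne'] at this
    norm_num at this
  refine (hball z hz).trans ?_
  rw [div_mul_eq_mul_div, le_div_iff₀ hδ]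
  nlinarith

end IsRidgeExponent

/-! ### Esseen's smoothing inequality with a Fejér kernel. -/

/-- The self-convolution of Lebesgue measure on `(-a, a]`. -/
noncomputable def triangleMeasure (a : ℝ) : Measure ℝ :=
  (volume.restrict (Set.Ioc (-a) a)).conv (volume.restrict (Set.Ioc (-a) a))

instance (a : ℝ) : IsFiniteMeasure (triangleMeasure a) := by
  unfold triangleMeasure; infer_instance

/-- The nonnegative, integrable smoothing kernel is thus itself the Fourier transform of a compactly
supported measure, so that smoothing sees frequencies up to 2a only and no Fourier inversion is
needed. -/
lemma charFun_triangleMeasure {a : ℝ} (ha : 0 < a) (x : ℝ) :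
    charFun (triangleMeasure a) x = (((2 * a * Real.sinc (a * x)) ^ 2 : ℝ) : ℂ) := by
  have h : charFun (volume.restrict (Set.Ioc (-a) a)) x = ((2 * a * Real.sinc (a * x) : ℝ) : ℂ) := by
    have := integral_charFun_Icc (μ := Measure.dirac x) ha
    rw [intervalIntegral.integral_of_le (by linarith), integral_dirac] at this
    rw [charFun_apply_real]
    simp only [charFun_dirac] at this
    rw [← Complex.ofReal_ofNat, ← Complex.ofReal_mul, ← Complex.ofReal_mul] at this
    rw [← this]
    refine integral_congr_ae (ae_of_all _ fun t => ?_)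
    simp [mul_comm]
  rw [triangleMeasure, charFun_conv, h]
  push_cast
  ring

lemma triangleMeasure_le (a : ℝ) :
    triangleMeasure a ≤ ENNReal.ofReal (2 * a) • volume := by
  refine Measure.le_iff.mpr fun s hs => ?_
  rw [triangleMeasure, Measure.conv, Measure.map_apply (by fun_prop) hs,
    Measure.prod_apply (measurable_add hs), Measure.smul_apply, smul_eq_mul]
  calc ∫⁻ x in Set.Ioc (-a) a, (volume.restrict (Set.Ioc (-a) a))
        (Prod.mk x ⁻¹' ((fun p : ℝ × ℝ => p.1 + p.2) ⁻¹' s))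
      ≤ ∫⁻ _ in Set.Ioc (-a) a, volume s := by
        refine lintegral_mono fun x => (Measure.restrict_apply_le _ _).trans (le_of_eq ?_)
        exact measure_preimage_add volume x s
    _ = ENNReal.ofReal (2 * a) * volume s := by
        rw [setLIntegral_const, Real.volume_Ioc, mul_comm]
        ring_nf

lemma ae_triangleMeasure_abs_le (a : ℝ) : ∀ᵐ t ∂(triangleMeasure a), |t| ≤ 2 * a := by
  rw [triangleMeasure, Measure.conv, ae_map_iff (by fun_prop)
    (measurableSet_le (by fun_prop) (by fun_prop)), Measure.prod_restrict]
  refine ae_restrict_of_forall_mem (measurableSet_Ioc.prod measurableSet_Ioc) ?_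
  rintro ⟨x, y⟩ ⟨⟨h1, h2⟩, h3, h4⟩
  simp only at h1 h2 h3 h4 ⊢
  rw [abs_le]
  constructor <;> linarith

/-- Fubini for the indicator of b' < u + v ≤ b. Increments are used since a single distribution
function would give a half-line, where the oscillating integrals below do not converge. -/
lemma integral_cdf_sub_mul (μ : Measure ℝ) [IsProbabilityMeasure μ] {V : ℝ → ℝ}
    (hV : Integrable V) {b' b : ℝ} (hb : b' ≤ b) :
    ∫ v, (cdf μ (b - v) - cdf μ (b' - v)) * V v = ∫ u, (∫ s in b'..b, V (s - u)) ∂μ := by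
  set S : Set (ℝ × ℝ) := {p | b' - p.1 < p.2 ∧ p.2 ≤ b - p.1} with hS
  have hSm : MeasurableSet S := by
    have h1 : MeasurableSet {p : ℝ × ℝ | b' - p.1 < p.2} :=
      measurableSet_lt (by fun_prop) (by fun_prop)
    have h2 : MeasurableSet {p : ℝ × ℝ | p.2 ≤ b - p.1} :=
      measurableSet_le (by fun_prop) (by fun_prop)
    exact h1.inter h2
  set f : ℝ → ℝ → ℝ := fun v u => S.indicator (fun p => V p.1) (v, u) with hf
  have hint : Integrable (Function.uncurry f) (volume.prod μ) := by
    have : Function.uncurry f = S.indicator fun p => V p.1 := by ext ⟨v, u⟩; rfl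
    rw [this]
    exact (hV.comp_fst μ).indicator hSm
  have h1 : ∀ v, ∫ u, f v u ∂μ = (cdf μ (b - v) - cdf μ (b' - v)) * V v := by
    intro v
    have e1 : f v = (Set.Ioc (b' - v) (b - v)).indicator fun _ => V v := by
      ext u; simp [hf, hS, Set.indicator]
    have e2 : μ.real (Set.Ioc (b' - v) (b - v)) = cdf μ (b - v) - cdf μ (b' - v) := by
      rw [cdf_eq_real, cdf_eq_real, ← Set.Iic_sdiff_Iic,
        measureReal_sdiff (Set.Iic_subset_Iic.mpr (by linarith)) measurableSet_Iic]
    rw [e1, integral_indicator_const _ measurableSet_Ioc, e2, smul_eq_mul]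
  have h2 : ∀ u, ∫ v, f v u = ∫ s in b'..b, V (s - u) := by
    intro u
    have e1 : (fun v => f v u) = (Set.Ioc (b' - u) (b - u)).indicator V := by
      ext v
      simp only [hf, hS, Set.indicator, Set.mem_ofPred_eq, Set.mem_Ioc]
      congr 1
      apply propext
      constructor <;> rintro ⟨h1, h2⟩ <;> constructor <;> linarith
    rw [e1, integral_indicator measurableSet_Ioc, intervalIntegral.integral_comp_sub_right,
      intervalIntegral.integral_of_le (by linarith)]
  exact (integral_congr_ae (ae_of_all _ fun v => (h1 v).symm)).trans
    ((integral_integral_swap hint).trans (integral_congr_ae (ae_of_all _ h2)))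

/-- Parseval's identity, obtained by expanding the transform of ρ and exchanging integrals. -/
lemma integral_charFun_sub (μ ρ : Measure ℝ) [IsFiniteMeasure μ] [IsFiniteMeasure ρ] (b' b : ℝ) :
    ∫ u : ℝ, (∫ s in b'..b, charFun ρ (s - u)) ∂μ =
      ∫ t : ℝ, charFun μ (-t) * (∫ s in b'..b, Complex.exp (t * Complex.I * s)) ∂ρ := by
  have h1 : ∀ u : ℝ, ∫ s in b'..b, charFun ρ (s - u) =
      ∫ t : ℝ, (∫ s in b'..b, Complex.exp ((s - u) * t * Complex.I)) ∂ρ := by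
    intro u
    simp_rw [charFun_apply_real]
    push_cast
    refine intervalIntegral_integral_swap ?_
    have : IsFiniteMeasure (volume.restrict (Set.uIoc b' b)) :=
      ⟨by rw [Measure.restrict_apply_univ]; exact measure_Ioc_lt_top⟩
    refine Integrable.of_bound (by fun_prop) 1 (ae_of_all _ fun p => ?_)
    simp only [Function.uncurry]
    norm_cast
    rw [Complex.norm_exp_ofReal_mul_I]
  simp_rw [h1]
  have h2 : Integrable (Function.uncurry fun (u t : ℝ) =>
      ∫ s in b'..b, Complex.exp ((s - u) * t * Complex.I)) (μ.prod ρ) := by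
    refine Integrable.of_bound (C := 1 * |b - b'|) ?_ (ae_of_all _ fun p => ?_)
    · refine Continuous.aestronglyMeasurable ?_
      refine intervalIntegral.continuous_parametric_intervalIntegral_of_continuous' ?_ _ _
      fun_prop
    · refine intervalIntegral.norm_integral_le_of_norm_le_const fun s _ => ?_
      norm_cast
      rw [Complex.norm_exp_ofReal_mul_I]
  rw [integral_integral_swap h2]
  refine integral_congr_ae (ae_of_all _ fun t => ?_)
  simp only
  rw [charFun_apply_real, ← integral_mul_const]
  refine integral_congr_ae (ae_of_all _ fun u => ?_)
  simp only
  rw [← intervalIntegral.integral_const_mul]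
  refine intervalIntegral.integral_congr fun s _ => ?_
  rw [← Complex.exp_add]
  congr 1
  push_cast
  ring

/-- Uniformity in b' and b is the point: it cancels the factor |t| in the hypothesis on
characteristic functions and survives b' → -∞. -/
lemma abs_mul_norm_integral_exp_le (t b' b : ℝ) :
    |t| * ‖∫ s in b'..b, Complex.exp (t * Complex.I * s)‖ ≤ 2 := by
  rcases eq_or_ne t 0 with rfl | ht
  · simp
  have hc : (t : ℂ) * Complex.I ≠ 0 := by simp [ht]
  rw [integral_exp_mul_complex hc, norm_div, norm_mul, Complex.norm_I, mul_one, Complex.norm_real,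
    Real.norm_eq_abs, mul_div_cancel₀ _ (abs_ne_zero.mpr ht)]
  refine (norm_sub_le _ _).trans ?_
  have : ∀ s : ℝ, ‖Complex.exp (t * Complex.I * s)‖ = 1 := by
    intro s
    rw [show (t : ℂ) * Complex.I * s = ((t * s : ℝ) : ℂ) * Complex.I by push_cast; ring,
      Complex.norm_exp_ofReal_mul_I]
  rw [this, this]
  norm_num

lemma integrable_sinc_sq : Integrable fun v : ℝ => Real.sinc v ^ 2 := by
  refine (integrable_inv_one_add_sq.const_mul 2).mono'
    (Real.continuous_sinc.pow 2).aestronglyMeasurable (ae_of_all _ fun v => ?_)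
  rw [Real.norm_of_nonneg (sq_nonneg _), ← div_eq_mul_inv, le_div_iff₀ (by positivity)]
  have h1 : Real.sinc v ^ 2 ≤ 1 := by
    rw [sq_le_one_iff_abs_le_one]; exact Real.abs_sinc_le_one v
  have h2 : (v * Real.sinc v) ^ 2 ≤ 1 := by
    rcases eq_or_ne v 0 with rfl | hv
    · simp
    · rw [Real.sinc_of_ne_zero hv, mul_div_cancel₀ _ hv]; exact Real.sin_sq_le_one v
  nlinarith

lemma integral_sinc_sq_pos : 0 < ∫ v : ℝ, Real.sinc v ^ 2 := by
  have hc : Continuous fun v : ℝ => Real.sinc v ^ 2 := Real.continuous_sinc.pow 2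
  rw [integral_pos_iff_support_of_nonneg (fun v => sq_nonneg _) integrable_sinc_sq]
  exact (hc.isOpen_support).measure_pos _ ⟨0, by simp⟩

lemma exists_integral_sinc_sq_tail : ∃ H : ℝ, 0 < H ∧
    ∫ v in {v : ℝ | H < |v|}, Real.sinc v ^ 2 ≤ (∫ v : ℝ, Real.sinc v ^ 2) / 4 := by
  have hc := integral_sinc_sq_pos
  have hlim : Tendsto (fun n : ℕ => ∫ v in {v : ℝ | (n : ℝ) < |v|}, Real.sinc v ^ 2) atTop (𝓝 0) := by
    have hm : ∀ n : ℕ, MeasurableSet {v : ℝ | (n : ℝ) < |v|} := fun n =>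
      measurableSet_lt (by fun_prop) (by fun_prop)
    simp_rw [← integral_indicator (hm _)]
    rw [← integral_zero ℝ ℝ]
    refine tendsto_integral_of_dominated_convergence (fun v => Real.sinc v ^ 2)
      (fun n => ((Real.continuous_sinc.pow 2).measurable.indicator (hm n)).aestronglyMeasurable)
      integrable_sinc_sq (fun n => ae_of_all _ fun v => ?_) (ae_of_all _ fun v => ?_)
    · rw [Real.norm_of_nonneg (Set.indicator_nonneg (fun _ _ => sq_nonneg _) _)]
      exact Set.indicator_le_self' (fun _ _ => sq_nonneg _) _
    · refine tendsto_const_nhds.congr' ?_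
      filter_upwards [eventually_ge_atTop ⌈|v|⌉₊] with n hn
      have : |v| ≤ n := (Nat.le_ceil _).trans (by exact_mod_cast hn)
      rw [Set.indicator_of_notMem (by simpa using this)]
  obtain ⟨n, hn, hn1⟩ := ((hlim.eventually (gt_mem_nhds (by positivity :
    0 < (∫ v : ℝ, Real.sinc v ^ 2) / 4))).and (eventually_ge_atTop 1)).exists
  exact ⟨n, by exact_mod_cast hn1, hn.le⟩

lemma integrable_mul_of_abs_le_one {D V : ℝ → ℝ} (hD : Measurable D) (hD1 : ∀ x, |D x| ≤ 1)
    (hV : Integrable V) : Integrable fun v => D v * V v :=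
  hV.bdd_mul hD.aestronglyMeasurable (ae_of_all _ hD1)

lemma measurable_cdf (μ : Measure ℝ) : Measurable (cdf μ) := (monotone_cdf μ).measurable

lemma abs_cdf_sub_cdf_le_one (μ ν : Measure ℝ) (x y : ℝ) : |cdf μ x - cdf ν y| ≤ 1 := by
  rw [abs_le]
  constructor <;> linarith [cdf_nonneg μ x, cdf_nonneg ν y, cdf_le_one μ x, cdf_le_one ν y]

lemma integrable_sinc_sq_comp {a : ℝ} (ha : 0 < a) :
    Integrable fun v : ℝ => (2 * a * Real.sinc (a * v)) ^ 2 := by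
  have := (integrable_sinc_sq.comp_mul_left' ha.ne').const_mul ((2 * a) ^ 2)
  refine this.congr (ae_of_all _ fun v => ?_)
  simp only
  ring

lemma abs_integral_increment_le (μ ν : Measure ℝ) [IsProbabilityMeasure μ]
    [IsProbabilityMeasure ν] {a : ℝ} (ha : 0 < a) {g : ℝ → ℝ} (hg0 : ∀ t, 0 ≤ g t)
    (hg : Integrable g)
    (hφ : ∀ t, |t| ≤ 2 * a → ‖charFun μ t - charFun ν t‖ ≤ |t| * g t) {b' b : ℝ} (hb : b' ≤ b) :
    |(∫ v, (cdf μ (b - v) - cdf μ (b' - v)) * (2 * a * Real.sinc (a * v)) ^ 2) -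
      ∫ v, (cdf ν (b - v) - cdf ν (b' - v)) * (2 * a * Real.sinc (a * v)) ^ 2| ≤
      4 * a * ∫ t, g t := by
  set ρ := triangleMeasure a with hρ
  set h : ℝ → ℂ := fun t => ∫ s in b'..b, Complex.exp (t * Complex.I * s) with hh
  have hV := integrable_sinc_sq_comp ha
  have key : ∀ (m : Measure ℝ) [IsProbabilityMeasure m],
      ((∫ v, (cdf m (b - v) - cdf m (b' - v)) * (2 * a * Real.sinc (a * v)) ^ 2 : ℝ) : ℂ) =
        ∫ t, charFun m (-t) * h t ∂ρ := by
    intro m _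
    rw [integral_cdf_sub_mul m hV hb, ← integral_charFun_sub]
    refine (integral_ofReal (𝕜 := ℂ)).symm.trans ?_
    refine integral_congr_ae (ae_of_all _ fun u => ?_)
    simp only
    refine intervalIntegral.integral_ofReal.symm.trans ?_
    refine intervalIntegral.integral_congr fun s _ => ?_
    rw [hρ, charFun_triangleMeasure ha]
  have hhb : ∀ t, ‖h t‖ ≤ 1 * |b - b'| := by
    intro t
    refine intervalIntegral.norm_integral_le_of_norm_le_const fun s _ => ?_
    rw [show (t : ℂ) * Complex.I * s = ((t * s : ℝ) : ℂ) * Complex.I by push_cast; ring,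
      Complex.norm_exp_ofReal_mul_I]
  have hhc : Continuous h := by
    refine intervalIntegral.continuous_parametric_intervalIntegral_of_continuous' ?_ _ _
    fun_prop
  have hint : ∀ (m : Measure ℝ) [IsProbabilityMeasure m],
      Integrable (fun t => charFun m (-t) * h t) ρ := by
    intro m _
    refine Integrable.of_bound (C := 1 * (1 * |b - b'|)) ?_ (ae_of_all _ fun t => ?_)
    · exact ((measurable_charFun.comp measurable_neg).mul hhc.measurable).aestronglyMeasurable
    · rw [norm_mul]
      exact mul_le_mul (norm_charFun_le_one _) (hhb t) (norm_nonneg _) zero_le_one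
  rw [← Real.norm_eq_abs, ← Complex.norm_real, Complex.ofReal_sub, key μ, key ν,
    ← integral_sub (hint μ) (hint ν)]
  have hgn : Integrable (fun t => 2 * g (-t)) (ENNReal.ofReal (2 * a) • volume) :=
    (hg.comp_neg.const_mul 2).smul_measure ENNReal.ofReal_ne_top
  have hle := triangleMeasure_le a
  calc ‖∫ t, (charFun μ (-t) * h t - charFun ν (-t) * h t) ∂ρ‖
      ≤ ∫ t, 2 * g (-t) ∂ρ := by
        refine norm_integral_le_of_norm_le (hgn.mono_measure hle) ?_
        filter_upwards [ae_triangleMeasure_abs_le a] with t ht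
        rw [← sub_mul, norm_mul]
        have h1 := hφ (-t) (by rwa [abs_neg])
        rw [abs_neg] at h1
        have h2 := abs_mul_norm_integral_exp_le t b' b
        calc ‖charFun μ (-t) - charFun ν (-t)‖ * ‖h t‖ ≤ |t| * g (-t) * ‖h t‖ := by gcongr
          _ = g (-t) * (|t| * ‖h t‖) := by ring
          _ ≤ g (-t) * 2 := mul_le_mul_of_nonneg_left h2 (hg0 _)
          _ = 2 * g (-t) := by ring
    _ ≤ ∫ t, 2 * g (-t) ∂(ENNReal.ofReal (2 * a) • volume) :=
        integral_mono_measure hle (ae_of_all _ fun t => mul_nonneg zero_le_two (hg0 _)) hgn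
    _ = 4 * a * ∫ t, g t := by
        rw [integral_smul_measure, ENNReal.toReal_ofReal (by positivity), integral_const_mul,
          integral_neg_eq_self g volume, smul_eq_mul]
        ring

lemma tendsto_integral_cdf_mul_atBot (μ : Measure ℝ) {V : ℝ → ℝ} (hV : Integrable V) :
    Tendsto (fun n : ℕ => ∫ v, cdf μ (-n - v) * V v) atTop (𝓝 0) := by
  have h0 : (∫ v, 0 * V v) = 0 := by simp
  rw [← h0]
  refine tendsto_integral_of_dominated_convergence (fun v => ‖V v‖)
    (fun n => (((measurable_cdf μ).comp (by fun_prop)).aestronglyMeasurable).mul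
      hV.aestronglyMeasurable) hV.norm
    (fun n => ae_of_all _ fun v => ?_) (ae_of_all _ fun v => ?_)
  · rw [norm_mul, Real.norm_of_nonneg (cdf_nonneg _ _)]
    exact mul_le_of_le_one_left (norm_nonneg _) (cdf_le_one _ _)
  · refine Tendsto.mul_const _ ((tendsto_cdf_atBot μ).comp ?_)
    exact tendsto_atBot_add_const_right _ (-v)
      (tendsto_neg_atTop_atBot.comp tendsto_natCast_atTop_atTop)

/-- The difference of two distribution functions, smoothed with a Fejér kernel. -/
lemma abs_integral_cdf_sub_mul_sinc_sq_le (μ ν : Measure ℝ) [IsProbabilityMeasure μ]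
    [IsProbabilityMeasure ν] {a : ℝ} (ha : 0 < a) {g : ℝ → ℝ} (hg0 : ∀ t, 0 ≤ g t)
    (hg : Integrable g)
    (hφ : ∀ t, |t| ≤ 2 * a → ‖charFun μ t - charFun ν t‖ ≤ |t| * g t) (b : ℝ) :
    |∫ v, (cdf μ (b - v / a) - cdf ν (b - v / a)) * Real.sinc v ^ 2| ≤ ∫ t, g t := by
  have hV := integrable_sinc_sq_comp ha
  have hI : ∀ (m : Measure ℝ) (c : ℝ),
      Integrable fun v => cdf m (c - v) * (2 * a * Real.sinc (a * v)) ^ 2 := fun m c =>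
    integrable_mul_of_abs_le_one ((measurable_cdf m).comp (by fun_prop))
      (fun x => by rw [abs_of_nonneg (cdf_nonneg _ _)]; exact cdf_le_one _ _) hV
  have hstep : ∀ᶠ n : ℕ in atTop,
      |((∫ v, cdf μ (b - v) * (2 * a * Real.sinc (a * v)) ^ 2) -
        ∫ v, cdf μ (-n - v) * (2 * a * Real.sinc (a * v)) ^ 2) -
        ((∫ v, cdf ν (b - v) * (2 * a * Real.sinc (a * v)) ^ 2) -
        ∫ v, cdf ν (-n - v) * (2 * a * Real.sinc (a * v)) ^ 2)| ≤ 4 * a * ∫ t, g t := by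
    filter_upwards [eventually_ge_atTop ⌈-b⌉₊] with n hn
    have hnb : -(n : ℝ) ≤ b := by
      have : -b ≤ n := (Nat.le_ceil _).trans (by exact_mod_cast hn)
      linarith
    have := abs_integral_increment_le μ ν ha hg0 hg hφ hnb
    simp_rw [sub_mul] at this
    rwa [integral_sub (hI μ b) (hI μ _), integral_sub (hI ν b) (hI ν _)] at this
  have hlim := (((tendsto_const_nhds (x := ∫ v, cdf μ (b - v) *
    (2 * a * Real.sinc (a * v)) ^ 2)).sub (tendsto_integral_cdf_mul_atBot μ hV)).sub
    ((tendsto_const_nhds (x := ∫ v, cdf ν (b - v) *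
    (2 * a * Real.sinc (a * v)) ^ 2)).sub (tendsto_integral_cdf_mul_atBot ν hV))).abs
  have hle := le_of_tendsto hlim hstep
  rw [sub_zero, sub_zero, ← integral_sub (hI μ b) (hI ν b)] at hle
  have hsub := Measure.integral_comp_mul_left (fun w => (cdf μ (b - w / a) - cdf ν (b - w / a)) *
    Real.sinc w ^ 2) a
  have heq : (∫ v, (cdf μ (b - v) * (2 * a * Real.sinc (a * v)) ^ 2 -
      cdf ν (b - v) * (2 * a * Real.sinc (a * v)) ^ 2)) = 4 * a ^ 2 *
      ∫ v, (cdf μ (b - a * v / a) - cdf ν (b - a * v / a)) * Real.sinc (a * v) ^ 2 := by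
    rw [← integral_const_mul]
    refine integral_congr_ae (ae_of_all _ fun v => ?_)
    simp only
    rw [mul_div_cancel_left₀ _ ha.ne']
    ring
  rw [heq, hsub, smul_eq_mul, abs_of_pos (inv_pos.mpr ha),
    show ∀ J : ℝ, 4 * a ^ 2 * (a⁻¹ * J) = 4 * a * J from fun J => by field_simp, abs_mul,
    abs_of_pos (by positivity : 0 < 4 * a)] at hle
  exact le_of_mul_le_mul_left hle (by positivity)

/-- Esseen's smoothing inequality with a non-explicit constant. -/
theorem exists_ksDist_le : ∃ C : ℝ, 0 < C ∧ ∀ (μ ν : Measure ℝ) [IsProbabilityMeasure μ]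
    [IsProbabilityMeasure ν], (∀ x y, x ≤ y → cdf ν y - cdf ν x ≤ y - x) →
    ∀ (T : ℝ), 0 < T → ∀ g : ℝ → ℝ, (∀ t, 0 ≤ g t) → Integrable g →
    (∀ t, |t| ≤ T → ‖charFun μ t - charFun ν t‖ ≤ |t| * g t) →
    ksDist μ ν ≤ C * ((∫ t, g t) + 1 / T) := by
  set c : ℝ := ∫ v : ℝ, Real.sinc v ^ 2 with hc
  have hc0 : 0 < c := integral_sinc_sq_pos
  obtain ⟨H, hH0, hH⟩ := exists_integral_sinc_sq_tail
  refine ⟨2 / c + 8 * H, by positivity, fun μ ν _ _ hν T hT g hg0 hg hφ => ?_⟩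
  set Δ : ℝ := ksDist μ ν with hΔ
  set a : ℝ := T / 2 with ha
  have ha0 : 0 < a := by positivity
  have hφ' : ∀ t, |t| ≤ 2 * a → ‖charFun μ t - charFun ν t‖ ≤ |t| * g t := fun t ht =>
    hφ t (by rw [ha] at ht; linarith)
  have hbdd : BddAbove (Set.range fun x => |cdf μ x - cdf ν x|) :=
    ⟨1, by rintro _ ⟨x, rfl⟩; exact abs_cdf_sub_cdf_le_one μ ν x x⟩
  have hle : ∀ x, |cdf μ x - cdf ν x| ≤ Δ := fun x => le_ciSup hbdd x
  have hΔ0 : 0 ≤ Δ := (abs_nonneg _).trans (hle 0)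
  have hg0' : 0 ≤ ∫ t, g t := integral_nonneg hg0
  set S : Set ℝ := {v | H < |v|} with hS
  have hSm : MeasurableSet S := measurableSet_lt (by fun_prop) (by fun_prop)
  -- Where |v| > H only D ≥ -Δ is known, and -Δ ≥ m - 2Δ; the kernel has mass at most c/4 there, so
  -- at most half of Δc is lost.
  have hlow : ∀ (D : ℝ → ℝ) (m : ℝ), Measurable D → (∀ v, |D v| ≤ 1) → (∀ v, -Δ ≤ D v) →
      m ≤ Δ → (∀ v, |v| ≤ H → m ≤ D v) →
      m * c - 2 * Δ * (c / 4) ≤ ∫ v, D v * Real.sinc v ^ 2 := by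
    intro D m hD hD1 hDΔ hm hDm
    have hi1 : Integrable fun v => m * Real.sinc v ^ 2 := integrable_sinc_sq.const_mul m
    have hi2 : Integrable fun v => 2 * Δ * S.indicator (fun v => Real.sinc v ^ 2) v :=
      (integrable_sinc_sq.indicator hSm).const_mul _
    calc m * c - 2 * Δ * (c / 4)
        ≤ m * c - 2 * Δ * ∫ v in S, Real.sinc v ^ 2 := by gcongr
      _ = ∫ v, (m * Real.sinc v ^ 2 - 2 * Δ * S.indicator (fun v => Real.sinc v ^ 2) v) := by
          rw [integral_sub hi1 hi2, integral_const_mul, integral_const_mul, integral_indicator hSm]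
      _ ≤ ∫ v, D v * Real.sinc v ^ 2 := by
          refine integral_mono (hi1.sub hi2)
            (integrable_mul_of_abs_le_one hD hD1 integrable_sinc_sq) fun v => ?_
          have h0 := sq_nonneg (Real.sinc v)
          by_cases hv : v ∈ S
          · simp only [Set.indicator_of_mem hv]
            have := hDΔ v
            nlinarith
          · simp only [Set.indicator_of_notMem hv, mul_zero, sub_zero]
            exact mul_le_mul_of_nonneg_right (hDm v (not_lt.mp hv)) h0
  have hm : ∀ b : ℝ, Measurable fun v => cdf μ (b - v / a) - cdf ν (b - v / a) := fun b =>
    ((measurable_cdf μ).comp (by fun_prop)).sub ((measurable_cdf ν).comp (by fun_prop))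
  have hva : ∀ v, |v| ≤ H → |v / a| ≤ H / a := by
    intro v hv
    rw [abs_div, abs_of_pos ha0]; gcongr
  have hmain : ∀ ε > 0, Δ ≤ (2 / c + 8 * H) * ((∫ t, g t) + 1 / T) + ε := by
    intro ε hε
    obtain ⟨x, hx⟩ := exists_lt_of_lt_ciSup (show Δ - ε / 2 < ⨆ x, |cdf μ x - cdf ν x| by
      rw [show (⨆ x, |cdf μ x - cdf ν x|) = Δ from rfl]; linarith)
    have hkey : (Δ - ε / 2 - 2 * (H / a)) * c - 2 * Δ * (c / 4) ≤ ∫ t, g t := by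
      have hHa : 0 < H / a := by positivity
      -- Near its supremum the difference stays large on an interval of length 2H/a on one side of
      -- x, as one cdf is monotone and the other 1-Lipschitz: to the right if the difference is
      -- positive, to the left if negative. The kernel is centred at the middle of that interval.
      rcases lt_abs.mp hx with hx | hx
      · have h1 := hlow _ (Δ - ε / 2 - 2 * (H / a)) (hm (x + H / a))
          (fun v => abs_cdf_sub_cdf_le_one _ _ _ _) (fun v => (abs_le.mp (hle _)).1)
          (by linarith) (fun v hv => by
            have h2 := abs_le.mp (hva v hv)
            have h3 := monotone_cdf μ (show x ≤ x + H / a - v / a by linarith)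
            have h4 := hν x (x + H / a - v / a) (by linarith)
            linarith)
        exact h1.trans ((le_abs_self _).trans
          (abs_integral_cdf_sub_mul_sinc_sq_le μ ν ha0 hg0 hg hφ' _))
      · have h1 := hlow (fun v => -(cdf μ (x - H / a - v / a) - cdf ν (x - H / a - v / a)))
          (Δ - ε / 2 - 2 * (H / a)) (hm (x - H / a)).neg
          (fun v => by rw [abs_neg]; exact abs_cdf_sub_cdf_le_one _ _ _ _)
          (fun v => neg_le_neg (abs_le.mp (hle _)).2)
          (by linarith) (fun v hv => by
            have h2 := abs_le.mp (hva v hv)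
            have h3 := monotone_cdf μ (show x - H / a - v / a ≤ x by linarith)
            have h4 := hν (x - H / a - v / a) x (by linarith)
            linarith)
        simp_rw [neg_mul] at h1
        rw [integral_neg] at h1
        exact h1.trans ((neg_le_abs _).trans
          (abs_integral_cdf_sub_mul_sinc_sq_le μ ν ha0 hg0 hg hφ' _))
    have h5 : H / a = 2 * H * (1 / T) := by rw [ha]; field_simp
    rw [h5] at hkey
    have h6 : c * (Δ / 2 - ε / 2 - 4 * H * (1 / T)) ≤ ∫ t, g t := by linarith
    rw [← le_div_iff₀' hc0] at h6
    have h7 : 0 ≤ 2 / c * (1 / T) + 8 * H * ∫ t, g t := by positivity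
    have h8 : (2 / c + 8 * H) * ((∫ t, g t) + 1 / T) =
      2 * ((∫ t, g t) / c) + 8 * H * (1 / T) + (2 / c * (1 / T) + 8 * H * ∫ t, g t) := by ring
    rw [h8]
    linarith
  exact le_of_forall_pos_le_add hmain

/-! ### The moment generating function and its logarithm. -/

lemma mem_interior_integrableExpSet {Ω : Type*} [MeasurableSpace Ω] {P : Measure Ω} {X : Ω → ℝ}
    {r : ℝ} (hX : AEMeasurable X P) (hint : Integrable (fun ω => Real.exp (r * |X ω|)) P) {v : ℝ}
    (hv : |v| < r) : v ∈ interior (integrableExpSet X P) := by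
  refine mem_interior.mpr ⟨{s | |s| < r}, fun s hs => ?_,
    isOpen_lt continuous_abs continuous_const, hv⟩
  refine hint.mono' (by fun_prop) (ae_of_all _ fun ω => ?_)
  rw [Real.norm_of_nonneg (Real.exp_pos _).le, Real.exp_le_exp]
  calc s * X ω ≤ |s * X ω| := le_abs_self _
    _ = |s| * |X ω| := abs_mul _ _
    _ ≤ r * |X ω| := mul_le_mul_of_nonneg_right (le_of_lt hs) (abs_nonneg _)

lemma complexCharFun_eq_complexMGF {Ω : Type*} [MeasurableSpace Ω] (P : Measure Ω) (X : Ω → ℝ)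
    (u : ℂ) : complexCharFun P X u = complexMGF X P (Complex.I * u) := rfl

/-- The logarithm of a zero-free moment generating function is a ridge exponent. -/
lemma exists_isRidgeExponent {Ω : Type*} [MeasurableSpace Ω] (P : Measure Ω)
    [IsProbabilityMeasure P] {X : Ω → ℝ} {r : ℝ} (hX : AEMeasurable X P) (hr : 0 < r)
    (hint : Integrable (fun ω => Real.exp (r * |X ω|)) P)
    (hne : ∀ z ∈ Metric.ball (0 : ℂ) r, complexMGF X P z ≠ 0) :
    ∃ K : ℂ → ℂ, IsRidgeExponent K r ∧
      (∀ z ∈ Metric.ball (0 : ℂ) r, Complex.exp (K z) = complexMGF X P z) ∧ K 0 = 0 ∧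
      deriv K 0 = ((∫ ω, X ω ∂P : ℝ) : ℂ) ∧ deriv (deriv K) 0 = ((variance X P : ℝ) : ℂ) := by
  set Ψ := complexMGF X P with hΨ
  have hstrip : ∀ z ∈ Metric.ball (0 : ℂ) r, z.re ∈ interior (integrableExpSet X P) := by
    intro z hz
    rw [mem_ball_zero_iff] at hz
    exact mem_interior_integrableExpSet hX hint ((Complex.abs_re_le_norm z).trans_lt hz)
  have hΨd : DifferentiableOn ℂ Ψ (Metric.ball 0 r) := differentiableOn_complexMGF.mono hstrip
  have hΨdat : ∀ z ∈ Metric.ball (0 : ℂ) r, HasDerivAt Ψ (deriv Ψ z) z := fun z hz =>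
    (hΨd.differentiableAt (Metric.isOpen_ball.mem_nhds hz)).hasDerivAt
  have hΨ'd : DifferentiableOn ℂ (deriv Ψ) (Metric.ball 0 r) := hΨd.deriv Metric.isOpen_ball
  have h0 : (0 : ℂ) ∈ Metric.ball (0 : ℂ) r := Metric.mem_ball_self hr
  have hΨ0 : Ψ 0 = 1 := by simp [hΨ, complexMGF]
  -- K is the primitive of Ψ'/Ψ vanishing at 0; the branch is fixed by K(0) = 0, and K is real on
  -- the real axis because Ψ'/Ψ is.
  obtain ⟨K, hK0, hK⟩ := (hΨ'd.div hΨd hne).isExactOn_ball.with_val_at 0 0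
  have hKd : DifferentiableOn ℂ K (Metric.ball 0 r) := fun z hz =>
    (hK z hz).differentiableAt.differentiableWithinAt
  have hexp : ∀ z ∈ Metric.ball (0 : ℂ) r, Complex.exp (K z) = Ψ z := by
    intro z hz
    have hder : ∀ w ∈ Metric.ball (0 : ℂ) r,
        HasDerivAt (fun w => Ψ w * Complex.exp (-K w)) 0 w := by
      intro w hw
      refine ((hΨdat w hw).mul (hK w hw).neg.cexp).congr_deriv ?_
      have := hne w hw
      rw [Pi.div_apply]
      field_simp
      ring
    have := Metric.isOpen_ball.is_const_of_deriv_eq_zero (convex_ball (0 : ℂ) r).isPreconnected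
      (fun w hw => (hder w hw).differentiableAt.differentiableWithinAt)
      (fun w hw => (hder w hw).deriv) hz h0
    simp only [hK0, hΨ0, neg_zero, Complex.exp_zero, mul_one, Complex.exp_neg] at this
    rw [mul_inv_eq_one₀ (Complex.exp_ne_zero _)] at this
    exact this.symm
  have hmemr : ∀ y : ℝ, |y| < r → (y : ℂ) ∈ Metric.ball (0 : ℂ) r := by
    intro y hy
    rwa [mem_ball_zero_iff, Complex.norm_real, Real.norm_eq_abs]
  have hΨre : ∀ y : ℝ, Ψ y = mgf X P y := fun y => complexMGF_ofReal y
  have hΨim : ∀ y : ℝ, |y| < r → (Ψ y).im = 0 := by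
    intro y _
    rw [hΨre, Complex.ofReal_im]
  have him : ∀ y : ℝ, |y| < r → (K y).im = 0 := by
    intro y hy
    have hder : ∀ s ∈ Metric.ball (0 : ℝ) r, HasDerivAt (fun s : ℝ => (K s).im) 0 s := by
      intro s hs
      rw [mem_ball_zero_iff, Real.norm_eq_abs] at hs
      have h1 := Complex.imCLM.hasFDerivAt.comp_hasDerivAt s (hK s (hmemr s hs)).comp_ofReal
      have h2 := deriv_im_eq_zero_of_im_eq_zero hΨd hΨim hs
      refine h1.congr_deriv ?_
      rw [Complex.imCLM_apply, Pi.div_apply, hΨre, Complex.div_ofReal_im, h2, zero_div]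
    have := Metric.isOpen_ball.is_const_of_deriv_eq_zero (convex_ball (0 : ℝ) r).isPreconnected
      (fun w hw => (hder w hw).differentiableAt.differentiableWithinAt)
      (fun w hw => (hder w hw).deriv) (show y ∈ Metric.ball (0 : ℝ) r by simpa using hy)
      (Metric.mem_ball_self hr)
    simpa [hK0] using this
  have hderK : deriv K =ᶠ[𝓝 0] fun z => (∫ ω, X ω * Complex.exp (z * X ω) ∂P) / Ψ z := by
    filter_upwards [Metric.isOpen_ball.mem_nhds h0] with z hz
    rw [(hK z hz).deriv, Pi.div_apply, (hasDerivAt_complexMGF (hstrip z hz)).deriv]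
  have hm1 : (∫ ω, X ω * Complex.exp (0 * X ω) ∂P) = ((∫ ω, X ω ∂P : ℝ) : ℂ) := by
    refine Eq.trans ?_ (integral_ofReal (𝕜 := ℂ))
    simp
  have hint0 := mem_interior_integrableExpSet hX hint (v := 0) (by simpa using hr)
  refine ⟨K, ⟨hKd, fun z hz => ?_, him⟩, hexp, hK0, ?_, ?_⟩
  · rw [← Real.exp_le_exp, ← Complex.norm_exp, ← Complex.norm_exp, hexp z hz]
    have hzr : |z.re| < r := (Complex.abs_re_le_norm z).trans_lt (by simpa using hz)
    rw [hexp _ (hmemr _ hzr), hΨre, Complex.norm_real, Real.norm_of_nonneg mgf_nonneg]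
    exact norm_complexMGF_le_mgf
  · rw [hderK.eq_of_nhds, hΨ0, div_one, hm1]
  · have hd1 := hasDerivAt_integral_pow_mul_exp (X := X) (μ := P) (hstrip 0 h0) 1
    have hd2 := hasDerivAt_complexMGF (X := X) (μ := P) (hstrip 0 h0)
    simp only [pow_one, Nat.reduceAdd] at hd1
    have hd := hd1.div hd2 (by rw [← hΨ, hΨ0]; exact one_ne_zero)
    rw [hderK.deriv_eq]
    refine hd.deriv.trans ?_
    rw [← hΨ, hΨ0, hm1, variance_eq_sub (memLp_of_mem_interior_integrableExpSet hint0 2)]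
    have hm2 : (∫ ω, (X ω : ℂ) ^ 2 * Complex.exp (0 * X ω) ∂P) =
        ((∫ ω, X ω ^ 2 ∂P : ℝ) : ℂ) := by
      refine Eq.trans ?_ (integral_ofReal (𝕜 := ℂ))
      simp
    rw [hm2]
    simp [pow_two]

/-- Convexity of the exponential replaces the maximum principle: the value at z is at most the mgf
at Re z, which lies below a convex combination of the mgf at ±r, and both of these are values on the
circle. -/
lemma norm_complexMGF_le_circleSup {Ω : Type*} [MeasurableSpace Ω] (P : Measure Ω)
    [IsProbabilityMeasure P] {X : Ω → ℝ} {r : ℝ} (hX : AEMeasurable X P) (hr : 0 < r)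
    (hint : Integrable (fun ω => Real.exp (r * |X ω|)) P) {z : ℂ} (hz : ‖z‖ ≤ r) :
    ‖complexMGF X P z‖ ≤ circleSup P X r := by
  have hmono : ∀ v : ℝ, |v| ≤ r → ∀ ω, Real.exp (v * X ω) ≤ Real.exp (r * |X ω|) := by
    intro v hv ω
    rw [Real.exp_le_exp]
    calc v * X ω ≤ |v * X ω| := le_abs_self _
      _ = |v| * |X ω| := abs_mul _ _
      _ ≤ r * |X ω| := mul_le_mul_of_nonneg_right hv (abs_nonneg _)
  have hintv : ∀ v : ℝ, |v| ≤ r → Integrable (fun ω => Real.exp (v * X ω)) P := by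
    intro v hv
    refine hint.mono' (by fun_prop) (ae_of_all _ fun ω => ?_)
    rw [Real.norm_of_nonneg (Real.exp_pos _).le]
    exact hmono v hv ω
  -- Needed because `sSup` of an unbounded set of reals is 0 by convention.
  have hbdd : BddAbove ((fun u : ℂ => ‖complexCharFun P X u‖) '' Metric.sphere (0 : ℂ) r) := by
    refine ⟨∫ ω, Real.exp (r * |X ω|) ∂P, ?_⟩
    rintro _ ⟨u, hu, rfl⟩
    simp only
    rw [complexCharFun_eq_complexMGF]
    have hv : |(Complex.I * u).re| ≤ r := by
      refine (Complex.abs_re_le_norm _).trans (le_of_eq ?_)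
      rw [norm_mul, Complex.norm_I, one_mul]
      simpa using hu
    exact norm_complexMGF_le_mgf.trans (integral_mono (hintv _ hv) hint (hmono _ hv))
  have hend : ∀ v : ℝ, |v| = r → mgf X P v ≤ circleSup P X r := by
    intro v hv
    refine le_csSup hbdd ⟨-Complex.I * v, ?_, ?_⟩
    · simp [hv]
    · simp only
      rw [complexCharFun_eq_complexMGF, ← mul_assoc, mul_neg, Complex.I_mul_I, neg_neg, one_mul,
        complexMGF_ofReal, Complex.norm_real, Real.norm_of_nonneg mgf_nonneg]
  have hre := (Complex.abs_re_le_norm z).trans hz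
  obtain ⟨h1, h2⟩ := abs_le.mp hre
  have hrr : |r| ≤ r := (abs_of_pos hr).le
  have hrn : |-r| ≤ r := by rw [abs_neg]; exact hrr
  have hconv := convexOn_exp.2
  set l : ℝ := (r + z.re) / (2 * r) with hl
  have hl0 : 0 ≤ l := div_nonneg (by linarith) (by linarith)
  have hl1 : 0 ≤ 1 - l := by
    rw [sub_nonneg, hl, div_le_one (by linarith)]; linarith
  have hlz : z.re = l * r + (1 - l) * (-r) := by
    rw [hl]; field_simp; ring
  calc ‖complexMGF X P z‖ ≤ mgf X P z.re := norm_complexMGF_le_mgf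
    _ ≤ ∫ ω, (l * Real.exp (r * X ω) + (1 - l) * Real.exp (-r * X ω)) ∂P := by
        refine integral_mono (hintv _ hre)
          (((hintv r hrr).const_mul l).add ((hintv (-r) hrn).const_mul (1 - l))) fun ω => ?_
        have := hconv (Set.mem_univ (r * X ω)) (Set.mem_univ (-r * X ω)) hl0 hl1 (by ring)
        simp only [smul_eq_mul] at this
        refine le_trans (le_of_eq ?_) this
        congr 1
        rw [hlz]; ring
    _ = l * mgf X P r + (1 - l) * mgf X P (-r) := by
        rw [integral_add ((hintv r hrr).const_mul l) ((hintv (-r) hrn).const_mul (1 - l)),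
          integral_const_mul, integral_const_mul]
        rfl
    _ ≤ l * circleSup P X r + (1 - l) * circleSup P X r := by
        gcongr
        · exact hend r (abs_of_pos hr)
        · exact hend (-r) (by rw [abs_neg, abs_of_pos hr])
    _ = circleSup P X r := by ring

/-! ### Taylor remainder, Gaussian and normalization estimates. -/

/-- Cauchy's estimate on unit circles bounds the third derivative by M; three mean value
inequalities then integrate it back. -/
lemma norm_sub_quadratic_le {f : ℂ → ℂ} {M : ℝ} (hf : DifferentiableOn ℂ f (Metric.ball 0 2))
    (hM : ∀ z ∈ Metric.ball (0 : ℂ) 2, ‖deriv (deriv f) z‖ ≤ M) {z : ℂ} (hz : ‖z‖ < 1) :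
    ‖f z - f 0 - deriv f 0 * z - deriv (deriv f) 0 * z ^ 2 / 2‖ ≤ M * ‖z‖ ^ 3 := by
  have hd1 : DifferentiableOn ℂ (deriv f) (Metric.ball 0 2) := hf.deriv Metric.isOpen_ball
  have hd2 : DifferentiableOn ℂ (deriv (deriv f)) (Metric.ball 0 2) := hd1.deriv Metric.isOpen_ball
  have hM0 : 0 ≤ M := (norm_nonneg _).trans (hM 0 (by simp))
  set B : Set ℂ := Metric.closedBall 0 ‖z‖ with hB
  have hBc : Convex ℝ B := convex_closedBall _ _
  have hB2 : ∀ w ∈ B, w ∈ Metric.ball (0 : ℂ) 2 := by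
    intro w hw
    rw [mem_closedBall_zero_iff] at hw
    rw [mem_ball_zero_iff]; linarith
  have h0B : (0 : ℂ) ∈ B := by simp [hB]
  have hzB : z ∈ B := by simp [hB]
  have hwB : ∀ w ∈ B, ‖w‖ ≤ ‖z‖ := fun w hw => by simpa [hB] using hw
  have hat : ∀ {g : ℂ → ℂ}, DifferentiableOn ℂ g (Metric.ball 0 2) → ∀ w ∈ B,
      HasDerivAt g (deriv g w) w := fun hg w hw =>
    (hg.differentiableAt (Metric.isOpen_ball.mem_nhds (hB2 w hw))).hasDerivAt
  have h3 : ∀ w ∈ B, ‖deriv (deriv (deriv f)) w‖ ≤ M := by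
    intro w hw
    have hsub : Metric.closedBall w 1 ⊆ Metric.ball (0 : ℂ) 2 := by
      refine Metric.closedBall_subset_ball' ?_
      rw [dist_zero_right]
      linarith [hwB w hw]
    have := Complex.norm_deriv_le_of_forall_mem_sphere_norm_le one_pos
      ((hd2.mono hsub).diffContOnCl_ball le_rfl)
      (fun v hv => hM v (hsub (Metric.sphere_subset_closedBall hv)))
    simpa using this
  have h2 : ∀ w ∈ B, ‖deriv (deriv f) w - deriv (deriv f) 0‖ ≤ M * ‖z‖ := by
    intro w hw
    have := hBc.norm_image_sub_le_of_norm_hasDerivWithin_le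
      (fun v hv => (hat hd2 v hv).hasDerivWithinAt) h3 h0B hw
    rw [sub_zero] at this
    exact this.trans (mul_le_mul_of_nonneg_left (hwB w hw) hM0)
  have h1 : ∀ w ∈ B, ‖deriv f w - deriv f 0 - deriv (deriv f) 0 * w‖ ≤ M * ‖z‖ * ‖z‖ := by
    intro w hw
    have := hBc.norm_image_sub_le_of_norm_hasDerivWithin_le
      (f := fun v => deriv f v - deriv (deriv f) 0 * v)
      (fun v hv => by
        exact (((hat hd1 v hv).sub
          ((hasDerivAt_id v).const_mul (deriv (deriv f) 0))).congr_deriv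
            (by rw [mul_one])).hasDerivWithinAt) h2 h0B hw
    simp only [mul_zero, sub_zero] at this
    rw [sub_right_comm]
    exact this.trans (mul_le_mul_of_nonneg_left (hwB w hw) (by positivity))
  have := hBc.norm_image_sub_le_of_norm_hasDerivWithin_le
      (f := fun v => f v - deriv f 0 * v - deriv (deriv f) 0 * v ^ 2 / 2)
      (f' := fun v => deriv f v - deriv f 0 - deriv (deriv f) 0 * v)
      (fun v hv => by
        have e1 := (hasDerivAt_id v).const_mul (deriv f 0)
        have e2 := (((hasDerivAt_id v).pow 2).const_mul (deriv (deriv f) 0)).div_const 2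
        exact ((((hat hf v hv).sub e1).sub e2).congr_deriv
          (by simp; ring)).hasDerivWithinAt) h1 h0B hzB
  simp only [mul_zero, sub_zero, ne_eq, OfNat.ofNat_ne_zero, not_false_eq_true, zero_pow,
    zero_div] at this
  calc ‖f z - f 0 - deriv f 0 * z - deriv (deriv f) 0 * z ^ 2 / 2‖
      = ‖f z - deriv f 0 * z - deriv (deriv f) 0 * z ^ 2 / 2 - f 0‖ := by congr 1; ring
    _ ≤ M * ‖z‖ * ‖z‖ * ‖z‖ := this
    _ = M * ‖z‖ ^ 3 := by ring

lemma cdf_gaussianReal_sub_le (x y : ℝ) (hxy : x ≤ y) :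
    cdf (gaussianReal 0 1) y - cdf (gaussianReal 0 1) x ≤ y - x := by
  have hpdf : ∀ u, gaussianPDF 0 1 u ≤ 1 := by
    intro u
    rw [gaussianPDF, ← ENNReal.ofReal_one]
    refine ENNReal.ofReal_le_ofReal ?_
    rw [gaussianPDFReal_def]
    refine mul_le_one₀ (inv_le_one_of_one_le₀ ?_) (Real.exp_pos _).le ?_
    · rw [Real.one_le_sqrt]
      have := Real.pi_gt_three
      simp
      linarith
    · rw [Real.exp_le_one_iff]
      exact div_nonpos_of_nonpos_of_nonneg (neg_nonpos.mpr (sq_nonneg _)) (by positivity)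
  rw [cdf_eq_real, cdf_eq_real, ← measureReal_sdiff (Set.Iic_subset_Iic.mpr hxy) measurableSet_Iic,
    Set.Iic_sdiff_Iic, measureReal_def]
  refine ENNReal.toReal_le_of_le_ofReal (by linarith) ?_
  rw [gaussianReal_apply _ one_ne_zero]
  refine (lintegral_mono hpdf).trans ?_
  simp

lemma Complex.norm_exp_sub_one_le_norm_mul_exp (ρ : ℂ) :
    ‖Complex.exp ρ - 1‖ ≤ ‖ρ‖ * Real.exp ‖ρ‖ := by
  have := (convex_closedBall (0 : ℂ) ‖ρ‖).norm_image_sub_le_of_norm_hasDerivWithin_le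
    (f := Complex.exp) (f' := Complex.exp) (C := Real.exp ‖ρ‖)
    (fun w _ => (Complex.hasDerivAt_exp w).hasDerivWithinAt)
    (fun w hw => (Complex.norm_exp_le_exp_norm w).trans
      (Real.exp_le_exp.mpr (by simpa using hw)))
    (x := 0) (y := ρ) (by simp) (by simp)
  rw [Complex.exp_zero, sub_zero, mul_comm] at this
  exact this

lemma one_le_numerator (x : ℝ) : 1 ≤ 1 + Real.posLog x := by
  linarith [Real.posLog_nonneg (x := x)]

lemma le_exp_one_add_posLog {x : ℝ} (hx : 0 ≤ x) : x ≤ Real.exp (1 + Real.posLog x) := by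
  rcases eq_or_lt_of_le hx with rfl | hx
  · exact (Real.exp_pos _).le
  · calc x = Real.exp (Real.log x) := (Real.exp_log hx).symm
      _ ≤ _ := Real.exp_le_exp.mpr (by
        have : Real.log x ≤ Real.posLog x := le_max_right _ _
        linarith)

/-- A ridge exponent bounded above has second derivative bounded on half the disk. -/
lemma IsRidgeExponent.norm_deriv_deriv_le_of_re_le {K : ℂ → ℂ} {Y L : ℝ} (hY : 1 ≤ Y)
    (hK : IsRidgeExponent K (2 * Y)) (h0 : K 0 = 0)
    (hL : ∀ z ∈ Metric.ball (0 : ℂ) (2 * Y), (K z).re ≤ L) {z : ℂ} (hz : ‖z‖ ≤ Y) :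
    ‖deriv (deriv K) z‖ ≤ Real.exp 7 * L := by
  have hY0 : 0 < Y := by linarith
  have hL0 : 0 ≤ L := by
    have := hL 0 (by simpa using hY0)
    rwa [h0, Complex.zero_re] at this
  set p : ℂ → ℂ := fun w => L - K w with hp
  have hpd : DifferentiableOn ℂ p (Metric.ball 0 (2 * Y)) := hK.differentiableOn.const_sub _
  have hre : ∀ w ∈ Metric.ball (0 : ℂ) (2 * Y), 0 ≤ (p w).re := by
    intro w hw
    simp only [hp, Complex.sub_re, Complex.ofReal_re, sub_nonneg]
    exact hL w hw
  have hsub : ∀ w : ℂ, ‖w‖ ≤ Y → Metric.ball w Y ⊆ Metric.ball (0 : ℂ) (2 * Y) := by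
    intro w hw
    refine Metric.ball_subset_ball' ?_
    rw [dist_zero_right]; linarith
  have h1 := norm_deriv_deriv_le_of_re_nonneg hY0 (hpd.mono (hsub z hz))
    (fun w hw => hre w (hsub z hz hw))
  have h2 := re_le_exp_mul_re (z₀ := 0) (z₁ := z) hY0 hpd hre (fun s hs => hsub _ (by
    rw [zero_add, sub_zero, norm_mul, Complex.norm_real, Real.norm_of_nonneg hs.1]
    exact (mul_le_of_le_one_left (norm_nonneg _) hs.2).trans hz))
  have hp0 : (p 0).re = L := by simp [hp, h0]
  rw [hp0, sub_zero] at h2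
  have h3 : Real.exp (2 * ‖z‖ / Y) ≤ Real.exp 2 := by
    rw [Real.exp_le_exp, div_le_iff₀ hY0]; linarith
  have h4 : (p z).re ≤ Real.exp 2 * L := h2.trans (mul_le_mul_of_nonneg_right h3 hL0)
  have hder : deriv (deriv p) z = -deriv (deriv K) z := by
    have : deriv p = fun w => -deriv K w := by
      funext w
      exact deriv_const_sub _
    rw [this, deriv.fun_neg]
  rw [hder, norm_neg] at h1
  refine h1.trans ?_
  calc 8 * Real.exp 2 * (p z).re / Y ^ 2 ≤ 8 * Real.exp 2 * (p z).re := by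
        refine div_le_self ?_ (one_le_pow₀ hY)
        have := hre z (hsub z hz (Metric.mem_ball_self hY0))
        positivity
    _ ≤ Real.exp 5 * (Real.exp 2 * L) := by
        gcongr
        · exact hre z (hsub z hz (Metric.mem_ball_self hY0))
        · exact IsRidgeExponent.eight_mul_exp_two_le
    _ = Real.exp 7 * L := by
        rw [← mul_assoc, ← Real.exp_add]; norm_num

lemma charFun_map_standardize {Ω : Type*} [MeasurableSpace Ω] (P : Measure Ω) {X : Ω → ℝ}
    (hX : AEMeasurable X P) (t : ℝ) :
    charFun (P.map (standardize P X)) t =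
      complexMGF X P (t * Complex.I / stdDev P X) *
        Complex.exp (-(t * Complex.I / stdDev P X * (∫ ω, X ω ∂P : ℝ))) := by
  have hm : AEMeasurable (standardize P X) P := by
    unfold standardize; fun_prop
  rw [← complexMGF_mul_I hm, complexMGF, complexMGF, ← integral_mul_const]
  refine integral_congr_ae (ae_of_all _ fun ω => ?_)
  simp only
  rw [← Complex.exp_add, standardize]
  congr 1
  push_cast
  ring

lemma cltRatio_pos {Ω : Type*} [MeasurableSpace Ω] {P : Measure Ω} {X : Ω → ℝ} {r : ℝ}
    (hr : 0 < r) (hσ : 0 < stdDev P X) : 0 < cltRatio P X r := by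
  have := one_le_numerator (Real.log (circleSup P X r))
  unfold cltRatio
  positivity

/-! ### The central limit theorem. -/

/-- The characteristic function of the standardized variable is close to the Gaussian one. -/
theorem exists_norm_charFun_sub_le : ∃ C : ℝ, 0 < C ∧ ∀ {Ω : Type*} [MeasurableSpace Ω]
    (P : Measure Ω) [IsProbabilityMeasure P] (X : Ω → ℝ) (r : ℝ), AEMeasurable X P →
    0 < stdDev P X → 0 < r → Integrable (fun ω => Real.exp (r * |X ω|)) P →
    (∀ u ∈ Metric.closedBall (0 : ℂ) r, complexCharFun P X u ≠ 0) → cltRatio P X r ≤ 1 / 8 →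
    ∀ t : ℝ, |t| * (C * cltRatio P X r) ≤ 1 →
    ‖charFun (P.map (standardize P X)) t - charFun (gaussianReal 0 1) t‖ ≤
      C * cltRatio P X r * |t| ^ 3 * Real.exp (-(1 / 4) * t ^ 2) := by
  obtain ⟨C₀, hC₀, hmain⟩ := IsRidgeExponent.exists_norm_deriv_deriv_le
  -- The 8 keeps |z| = 8κ|t| below 1, and 32C₀ keeps the remainder 8C₀κ|t|³ below t²/4.
  refine ⟨32 * C₀ + 8, by positivity, ?_⟩
  intro Ω _ P _ X r hX hσ hr hint hne hκ8 t ht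
  have hκ := cltRatio_pos hr hσ
  set κ : ℝ := cltRatio P X r with hκdef
  set σ : ℝ := stdDev P X with hσdef
  set L : ℝ := Real.log (circleSup P X r) with hLdef
  set l : ℝ := 1 + Real.posLog L with hl
  have hl1 : 1 ≤ l := one_le_numerator L
  set m : ℝ := ∫ ω, X ω ∂P with hm
  obtain ⟨K, hK, hexp, hK0, hK1, hK2⟩ := exists_isRidgeExponent P hX hr hint (by
    intro z hz
    have := hne (-Complex.I * z) (by
      rw [mem_ball_zero_iff] at hz
      simpa using hz.le)
    rwa [complexCharFun_eq_complexMGF, ← mul_assoc, mul_neg, Complex.I_mul_I, neg_neg,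
      one_mul] at this)
  have hvar : variance X P = σ ^ 2 := (Real.sq_sqrt (variance_nonneg X P)).symm
  -- This Y makes e^{4Y} exceed the a priori bound e⁷L ≤ e^{7+l} for the rescaled second derivative;
  -- κ ≤ 1/8 gives τ ≥ 1, so the bound also holds relative to K₁''(0) = τ².
  set Y : ℝ := 4 * l with hY
  have hY4 : 4 ≤ Y := by linarith
  set s : ℝ := r / (2 * Y) with hs
  have hs0 : 0 < s := by positivity
  have hsY : s * (2 * Y) = r := by rw [hs]; field_simp
  set τ : ℝ := s * σ with hτ
  have hτ0 : 0 < τ := by positivity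
  have hτκ : τ⁻¹ = 8 * κ := by
    rw [hτ, hs, hY, hκdef, cltRatio, ← hLdef, ← hσdef, ← hl]
    field_simp
    norm_num
  have hτ1 : 1 ≤ τ := by
    have : τ⁻¹ ≤ 1 := by rw [hτκ]; linarith
    exact (inv_le_one₀ hτ0).mp this
  set K₁ : ℂ → ℂ := fun z => K (s * z) with hK₁
  have hR : IsRidgeExponent K₁ (2 * Y) := hK.comp_mul (by rw [abs_of_pos hs0, hsY]) hs0.ne'
  have hK₁0 : K₁ 0 = 0 := by simp [hK₁, hK0]
  have hK₁1 : deriv K₁ 0 = s * m := by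
    rw [hK₁, deriv_comp_mul_left, mul_zero, hK1, smul_eq_mul]
  have hK₁2 : deriv (deriv K₁) 0 = ((τ ^ 2 : ℝ) : ℂ) := by
    rw [hK₁, deriv_deriv_comp_mul, mul_zero, hK2, hvar, hτ]
    push_cast
    ring
  have hn2 : ‖deriv (deriv K₁) 0‖ = τ ^ 2 := by
    rw [hK₁2, Complex.norm_real, Real.norm_of_nonneg (sq_nonneg _)]
  have hscale : ∀ z ∈ Metric.ball (0 : ℂ) (2 * Y), (s * z : ℂ) ∈ Metric.ball (0 : ℂ) r := by
    intro z hz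
    rw [mem_ball_zero_iff] at hz ⊢
    rw [norm_mul, Complex.norm_real, Real.norm_of_nonneg hs0.le, ← hsY]
    exact mul_lt_mul_of_pos_left hz hs0
  have hL : ∀ z ∈ Metric.ball (0 : ℂ) (2 * Y), (K₁ z).re ≤ L := by
    intro z hz
    have hz' := hscale z hz
    have h1 := norm_complexMGF_le_circleSup P hX hr hint (mem_ball_zero_iff.mp hz').le
    rw [← hexp _ hz', Complex.norm_exp] at h1
    rw [hLdef, Real.le_log_iff_exp_le ((Real.exp_pos _).trans_le h1)]
    exact h1
  have hL0 : 0 ≤ L := by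
    have := hL 0 (by simp; linarith)
    rwa [hK₁0, Complex.zero_re] at this
  have hgrow : ∀ z : ℂ, ‖z‖ ≤ Y →
      ‖deriv (deriv K₁) z‖ ≤ Real.exp (4 * Y) * ‖deriv (deriv K₁) 0‖ := by
    intro z hz
    calc ‖deriv (deriv K₁) z‖ ≤ Real.exp 7 * L :=
          hR.norm_deriv_deriv_le_of_re_le (by linarith) hK₁0 hL hz
      _ ≤ Real.exp 7 * Real.exp l := by
          gcongr
          exact le_exp_one_add_posLog hL0
      _ = Real.exp (7 + l) := (Real.exp_add _ _).symm
      _ ≤ Real.exp (4 * Y) * 1 := by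
          rw [mul_one, Real.exp_le_exp]; linarith
      _ ≤ Real.exp (4 * Y) * ‖deriv (deriv K₁) 0‖ := by
          gcongr
          rw [hn2]
          exact one_le_pow₀ hτ1
  have hbound := hmain K₁ Y hY4 hR (by
    rw [← norm_ne_zero_iff, hn2]; positivity) hgrow
  rw [hn2] at hbound
  set z : ℂ := t * Complex.I / τ with hz
  have hzn : ‖z‖ = 8 * κ * |t| := by
    rw [hz, norm_div, norm_mul, Complex.norm_I, mul_one, Complex.norm_real, Complex.norm_real,
      Real.norm_eq_abs, Real.norm_of_nonneg hτ0.le, div_eq_mul_inv, hτκ, mul_comm]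
  have hz1 : ‖z‖ < 1 := by
    rw [hzn]
    rcases eq_or_ne t 0 with rfl | ht0
    · simp
    · have h1 : 0 < C₀ * κ * |t| := by have := abs_pos.mpr ht0; positivity
      nlinarith
  have hquad := norm_sub_quadratic_le (hR.differentiableOn.mono
    (Metric.ball_subset_ball (by linarith))) hbound hz1
  set ρ : ℂ := K₁ z - K₁ 0 - deriv K₁ 0 * z - deriv (deriv K₁) 0 * z ^ 2 / 2 with hρ
  have hρn : ‖ρ‖ ≤ 8 * C₀ * κ * |t| ^ 3 := by
    refine hquad.trans (le_of_eq ?_)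
    have h1 : τ * (8 * κ) = 1 := by rw [← hτκ]; exact mul_inv_cancel₀ hτ0.ne'
    rw [hzn]
    calc C₀ * τ ^ 2 * (8 * κ * |t|) ^ 3
        = C₀ * (τ * (8 * κ)) ^ 2 * (8 * κ * |t| ^ 3) := by ring
      _ = 8 * C₀ * κ * |t| ^ 3 := by rw [h1]; ring
  have hρ4 : ‖ρ‖ ≤ 1 / 4 * t ^ 2 := by
    refine hρn.trans ?_
    have h1 : 32 * C₀ * κ * |t| ≤ 1 := by
      have : 0 ≤ κ * |t| := by positivity
      nlinarith
    have h2 : |t| ^ 3 = |t| * t ^ 2 := by rw [pow_succ', sq_abs]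
    rw [h2]
    nlinarith [sq_nonneg t]
  have hsz : (s * z : ℂ) = t * Complex.I / σ := by
    rw [hz, hτ]
    have h1 : (s : ℂ) ≠ 0 := by exact_mod_cast hs0.ne'
    have h2 : (σ : ℂ) ≠ 0 := by exact_mod_cast hσ.ne'
    push_cast
    field_simp
  have hchar : charFun (P.map (standardize P X)) t = Complex.exp (-(t ^ 2 / 2) + ρ) := by
    rw [charFun_map_standardize P hX, ← hσdef, ← hm, ← hsz, ← hexp _ (hscale z (by
      rw [mem_ball_zero_iff]; linarith)), ← Complex.exp_add]
    congr 1
    have h1 : deriv (deriv K₁) 0 * z ^ 2 = -t ^ 2 := by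
      have h2 : (τ : ℂ) ≠ 0 := by exact_mod_cast hτ0.ne'
      have h3 : ((t : ℂ) * Complex.I) ^ 2 = -t ^ 2 := by rw [mul_pow, Complex.I_sq, mul_neg_one]
      rw [hK₁2, hz, div_pow, h3, Complex.ofReal_pow, mul_div_cancel₀ _ (pow_ne_zero 2 h2)]
    rw [hρ, h1, hK₁0, hK₁1]
    ring
  have hgauss : charFun (gaussianReal 0 1) t = Complex.exp (-(t ^ 2 / 2)) := by
    rw [charFun_gaussianReal]
    simp
  rw [hchar, hgauss, Complex.exp_add, ← mul_sub_one, norm_mul]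
  have h1 : ‖Complex.exp (-((t : ℂ) ^ 2 / 2))‖ = Real.exp (-(t ^ 2 / 2)) := by
    rw [Complex.norm_exp]
    norm_cast
  rw [h1]
  calc Real.exp (-(t ^ 2 / 2)) * ‖Complex.exp ρ - 1‖
      ≤ Real.exp (-(t ^ 2 / 2)) * (8 * C₀ * κ * |t| ^ 3 * Real.exp (1 / 4 * t ^ 2)) := by
        gcongr
        refine (Complex.norm_exp_sub_one_le_norm_mul_exp ρ).trans ?_
        gcongr
    _ = 8 * C₀ * κ * |t| ^ 3 * Real.exp (-(1 / 4) * t ^ 2) := by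
        rw [mul_left_comm, ← Real.exp_add]
        ring_nf
    _ ≤ (32 * C₀ + 8) * κ * |t| ^ 3 * Real.exp (-(1 / 4) * t ^ 2) := by
        gcongr
        linarith

lemma integrable_sq_mul_exp_neg : Integrable fun t : ℝ => t ^ 2 * Real.exp (-(1 / 4) * t ^ 2) := by
  have := integrable_rpow_mul_exp_neg_mul_sq (b := 1 / 4) (by norm_num) (s := 2) (by norm_num)
  simpa using this

/-- The Kolmogorov distance bound for a single random variable. -/
theorem exists_ksDist_le_cltRatio : ∃ A : ℝ, 0 < A ∧ ∀ {Ω : Type*} [MeasurableSpace Ω]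
    (P : Measure Ω) [IsProbabilityMeasure P] (X : Ω → ℝ) (r : ℝ), AEMeasurable X P →
    0 < stdDev P X → 0 < r → Integrable (fun ω => Real.exp (r * |X ω|)) P →
    (∀ u ∈ Metric.closedBall (0 : ℂ) r, complexCharFun P X u ≠ 0) →
    ksDist (P.map (standardize P X)) (gaussianReal 0 1) ≤ A * cltRatio P X r := by
  obtain ⟨C₁, hC₁, h₁⟩ := exists_norm_charFun_sub_le
  obtain ⟨C₂, hC₂, h₂⟩ := exists_ksDist_le
  set J : ℝ := ∫ t : ℝ, t ^ 2 * Real.exp (-(1 / 4) * t ^ 2) with hJ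
  have hJ0 : 0 ≤ J := integral_nonneg fun t => by positivity
  refine ⟨C₂ * C₁ * (J + 1) + 8, by positivity, ?_⟩
  intro Ω _ P _ X r hX hσ hr hint hne
  have hκ := cltRatio_pos hr hσ
  set κ : ℝ := cltRatio P X r with hκdef
  have hm : AEMeasurable (standardize P X) P := by
    unfold standardize; fun_prop
  have : IsProbabilityMeasure (P.map (standardize P X)) := Measure.isProbabilityMeasure_map hm
  -- For κ > 1/8 the trivial bound 1 < 8κ suffices, which explains the summand 8 in the constant.
  -- Otherwise smoothing is applied at T = 1/(C₁κ), exactly the range where the characteristic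
  -- function estimate holds.
  rcases le_or_gt κ (1 / 8) with hκ8 | hκ8
  · have hks := h₂ (P.map (standardize P X)) (gaussianReal 0 1) cdf_gaussianReal_sub_le
      (1 / (C₁ * κ)) (by positivity) (fun t => C₁ * κ * (t ^ 2 * Real.exp (-(1 / 4) * t ^ 2)))
      (fun t => by positivity) (integrable_sq_mul_exp_neg.const_mul _) (fun t ht => by
        rw [le_div_iff₀ (by positivity)] at ht
        refine (h₁ P X r hX hσ hr hint hne hκ8 t ht).trans (le_of_eq ?_)
        have h2 : |t| ^ 3 = |t| * t ^ 2 := by rw [pow_succ', sq_abs]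
        rw [h2]
        ring)
    rw [integral_const_mul, ← hJ, one_div_one_div] at hks
    calc _ ≤ C₂ * (C₁ * κ * J + C₁ * κ) := hks
      _ = C₂ * C₁ * (J + 1) * κ := by ring
      _ ≤ (C₂ * C₁ * (J + 1) + 8) * κ := by gcongr; linarith
  · have h1 : ksDist (P.map (standardize P X)) (gaussianReal 0 1) ≤ 1 :=
      ciSup_le fun x => abs_cdf_sub_cdf_le_one _ _ x x
    have h3 : 0 ≤ C₂ * C₁ * (J + 1) * κ := by positivity
    linarith

theorem corollary1p3 :
    ∃ A : ℝ, 0 < A ∧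
      ∀ (Ω : ℕ → Type*) [∀ n, MeasurableSpace (Ω n)]
        (P : (n : ℕ) → Measure (Ω n)) [∀ n, IsProbabilityMeasure (P n)]
        (X : (n : ℕ) → Ω n → ℝ) (r : ℕ → ℝ),
        (∀ n, AEMeasurable (X n) (P n)) →
        (∀ n, 0 < stdDev (P n) (X n)) →
        (∀ n, 0 < r n) →
        (∀ n, Integrable (fun ω => Real.exp (r n * |X n ω|)) (P n)) →
        (∀ n, ∀ u ∈ Metric.closedBall (0 : ℂ) (r n), complexCharFun (P n) (X n) u ≠ 0) →
        Tendsto (fun n => cltRatio (P n) (X n) (r n)) atTop (𝓝 0) →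
          TendstoInDistribution (fun n => standardize (P n) (X n)) atTop
              (id : ℝ → ℝ) P (gaussianReal 0 1) ∧
            ∀ n, ksDist ((P n).map (standardize (P n) (X n))) (gaussianReal 0 1) ≤
              A * cltRatio (P n) (X n) (r n) := by
  obtain ⟨C, hC, hchar⟩ := exists_norm_charFun_sub_le
  obtain ⟨A, hA, hks⟩ := exists_ksDist_le_cltRatio
  refine ⟨A, hA, fun Ω _ P _ X r hX hσ hr hint hne hlim => ⟨?_, fun n =>
    hks (P n) (X n) (r n) (hX n) (hσ n) (hr n) (hint n) (hne n)⟩⟩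
  refine ⟨fun n => by have := hX n; unfold standardize; fun_prop, by fun_prop, ?_⟩
  -- Lévy's continuity theorem: for fixed t, the ratio tending to 0 eventually brings t into the
  -- range of the estimate and sends its right side to 0.
  refine ProbabilityMeasure.tendsto_iff_tendsto_charFun.2 fun t => ?_
  rw [tendsto_iff_norm_sub_tendsto_zero]
  have hlim1 : Tendsto (fun n => |t| * (C * cltRatio (P n) (X n) (r n))) atTop (𝓝 0) := by
    simpa using (hlim.const_mul C).const_mul |t|
  have hlim2 : Tendsto (fun n => C * cltRatio (P n) (X n) (r n) * |t| ^ 3 *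
      Real.exp (-(1 / 4) * t ^ 2)) atTop (𝓝 0) := by
    have := ((hlim.const_mul C).mul_const (|t| ^ 3)).mul_const (Real.exp (-(1 / 4) * t ^ 2))
    rwa [mul_zero, zero_mul, zero_mul] at this
  refine squeeze_zero' (Eventually.of_forall fun n => norm_nonneg _) ?_ hlim2
  filter_upwards [hlim.eventually (ge_mem_nhds (show (0 : ℝ) < 1 / 8 by norm_num)),
    hlim1.eventually (ge_mem_nhds one_pos)] with n hn8 hn1
  have := hchar (P n) (X n) (r n) (hX n) (hσ n) (hr n) (hint n) (hne n) hn8 t hn1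
  simpa using this
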